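/- Let $\lambda\in(0,1)$, $0\le x_0<\lambda$, and let $f_L,f_R:\mathbb R\to(0,1)$ be $C^2$ and $2$-periodic. A point ball moves in the unit square $[0,1]^2$ with horizontal speed $1$; at time $0$ its horizontal position is $x_0$ and it moves to the right, so that it crosses $x=\lambda$ exactly at the times congruent modulo $2$ to $t_1^*=\lambda-x_0$ (from left to right) or $t_2^*=2-\lambda-x_0$ (from right to left). At time $t$ two horizontal slits are at height $f_L(t)$ over $0\le x\le\lambda$ and at height $f_R(t)$ over $\lambda\le x\le1$. The ball is reflected elastically by the sides of the square and by the moving slits (on a collision with a slit its vertical velocity relative to the slit changes sign). Write $t_0<t_1<\dots$ for the times of its successive collisions with the slits and $v_0,v_1,\dots$ for its vertical velocities immediately after them; the orbit is determined by the initial condition $(t_0,v_0)\in[0,2)\times\mathbb R$. Orbits with a collision at $x=\lambda$ are excluded. An orbit eventually gains energy exponentially in time if $t_n\to\infty$ and there are $C,\zeta>0$ and $T$ such that the vertical speed satisfies $|v(t)|\ge Ce^{\zeta t}$ for all $t\ge T$, where $|v(t)|=|v_n|$ for $t_n\le t<t_{n+1}$. Suppose that $f_L(t_1^*)<f_R(t_1^*)$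 and $f_L(t_2^*)>f_R(t_2^*)$, or that $f_L(t_1^*)>f_R(t_1^*)$ and $f_L(t_2^*)<f_R(t_2^*)$. Then there is $V_*>1$, which depends only on the system (that is, on $f_L$, $f_R$, $\lambda$ and $x_0$), such that the orbit of Lebesgue-almost every $(t_0,v_0)\in[0,2)\times\mathbb R$ with $|v_0|>V_*$ eventually gains energy exponentially in time. In particular, the set of initial conditions $(t_0,v_0)\in[0,2)\times\mathbb R$ whose orbit does not eventually gain energy exponentially in time has finite Lebesgue measure. -/

import Mathlib

open Filter MeasureTheory Set

namespace SlitBilliard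

/-- Folding of the line onto `[0, 1]`: the distance from `u` to the nearest even integer. A point
moving with constant velocity on the line is folded to a point that moves in `[0, 1]` and is
reflected elastically at `0` and `1`. -/
noncomputable def fold (u : ℝ) : ℝ := |u - 2 * (round (u / 2) : ℝ)|

/-- Horizontal position at time `t` of the ball in the unit square; it is at `x₀` at time `0`,
starts to the right, and has horizontal speed `1`. -/
noncomputable def xPos (x₀ t : ℝ) : ℝ := fold (x₀ + t)

/-- Height, at time `t`, of the slit above or below the ball: the left slit occupies the horizontal
positions `0 ≤ x ≤ lam`, the right slit `lam ≤ x ≤ 1`. (Only used when `xPos x₀ t ≠ lam`.) -/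
noncomputable def slitHeight (fL fR : ℝ → ℝ) (lam x₀ t : ℝ) : ℝ :=
  if xPos x₀ t < lam then fL t else fR t

/-- Vertical velocity, at time `t`, of the slit above or below the ball.
(Only used when `xPos x₀ t ≠ lam`.) -/
noncomputable def slitVel (fL fR : ℝ → ℝ) (lam x₀ t : ℝ) : ℝ :=
  if xPos x₀ t < lam then deriv fL t else deriv fR t

/-- At time `s`, a ball at height `y` touches one of the two slits (endpoints included). -/
def Touches (fL fR : ℝ → ℝ) (lam x₀ s y : ℝ) : Prop :=
  (xPos x₀ s ≤ lam ∧ y = fL s) ∨ (lam ≤ xPos x₀ s ∧ y = fR s)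

/-- The unfolded height at time `s` of a ball that leaves the slit at time `p.1` with vertical
velocity `p.2` and that has not met a slit since. -/
noncomputable def unfolded (fL fR : ℝ → ℝ) (lam x₀ : ℝ) (p : ℝ × ℝ) (s : ℝ) : ℝ :=
  slitHeight fL fR lam x₀ p.1 + p.2 * (s - p.1)

/-- The height at time `s` of that ball in the table: the floor is at height `0` and the ceiling
at height `1`. -/
noncomputable def flightHeight (fL fR : ℝ → ℝ) (lam x₀ : ℝ) (p : ℝ × ℝ) (s : ℝ) : ℝ :=
  fold (unfolded fL fR lam x₀ p s)

/-- The vertical velocity at time `s` of that ball: the sign changes at each reflection in the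
floor or the ceiling. -/
noncomputable def flightVel (fL fR : ℝ → ℝ) (lam x₀ : ℝ) (p : ℝ × ℝ) (s : ℝ) : ℝ :=
  (-1 : ℝ) ^ ⌊unfolded fL fR lam x₀ p s⌋ * p.2

/-- `(t, v)` is the state of the ball just after a non-degenerate collision with a slit: the ball
is not at the common endpoint `x = lam` of the slits, and it moves away from the slit. It is in the
upper chamber if `v` exceeds the velocity of the slit, and in the lower chamber otherwise. -/
def IsCollisionState (fL fR : ℝ → ℝ) (lam x₀ : ℝ) (p : ℝ × ℝ) : Prop :=
  xPos x₀ p.1 ≠ lam ∧ p.2 ≠ slitVel fL fR lam x₀ p.1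

/-- The graph of the collision map: `q` is the state just after the first collision with a slit
that follows the state `p`. The collision is elastic: the velocity relative to the slit is
reversed. There is no next state if the ball touches a slit at `x = lam` first. -/
def IsNextCollision (fL fR : ℝ → ℝ) (lam x₀ : ℝ) (p q : ℝ × ℝ) : Prop :=
  p.1 < q.1 ∧
  (∀ s ∈ Ioo p.1 q.1, ¬ Touches fL fR lam x₀ s (flightHeight fL fR lam x₀ p s)) ∧
  Touches fL fR lam x₀ q.1 (flightHeight fL fR lam x₀ p q.1) ∧
  q.2 = 2 * slitVel fL fR lam x₀ q.1 - flightVel fL fR lam x₀ p q.1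

/-- The collision map is single-valued. -/
theorem IsNextCollision.unique {fL fR : ℝ → ℝ} {lam x₀ : ℝ} {p q q' : ℝ × ℝ}
    (h : IsNextCollision fL fR lam x₀ p q) (h' : IsNextCollision fL fR lam x₀ p q') : q = q' := by
  obtain ⟨h1, h2, h3, h4⟩ := h
  obtain ⟨h1', h2', h3', h4'⟩ := h'
  have ht : q.1 = q'.1 := by
    rcases lt_trichotomy q.1 q'.1 with hlt | heq | hgt
    · exact absurd h3 (h2' _ ⟨h1, hlt⟩)
    · exact heq
    · exact absurd h3' (h2 _ ⟨h1', hgt⟩)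
  refine Prod.ext ht ?_
  rw [h4, h4', ht]

/-- The (forward) orbit of the collision map: the sequence of the times and of the vertical
velocities just after the successive collisions with the slits. -/
def IsOrbit (fL fR : ℝ → ℝ) (lam x₀ : ℝ) (o : ℕ → ℝ × ℝ) : Prop :=
  ∀ n, IsCollisionState fL fR lam x₀ (o n) ∧ IsNextCollision fL fR lam x₀ (o n) (o (n + 1))

/-- Exponential growth in time along an orbit: the orbit is defined for all future times, and the
vertical speed at time `s`, which is `|(o n).2|` between the `n`-th collision and the next one, is
at least `C * exp (ζ * s)` for all large times `s`, with constants `C, ζ > 0`. -/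
def GrowsExponentially (o : ℕ → ℝ × ℝ) : Prop :=
  Tendsto (fun n => (o n).1) atTop atTop ∧
  ∃ C > 0, ∃ ζ > 0, ∃ T : ℝ, ∀ s ≥ T, ∀ n : ℕ, (o n).1 ≤ s → s < (o (n + 1)).1 →
    C * Real.exp (ζ * s) ≤ |(o n).2|

/-- The (unique) orbit with initial condition `p = (t₀, v₀)` exists for all future times and
eventually gains energy exponentially in time. -/
def GainsEnergyExponentially (fL fR : ℝ → ℝ) (lam x₀ : ℝ) (p : ℝ × ℝ) : Prop :=
  ∃ o : ℕ → ℝ × ℝ, o 0 = p ∧ IsOrbit fL fR lam x₀ o ∧ GrowsExponentially o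

end SlitBilliard

/-!
For definiteness let the slit that the ball leaves be below the one that it reaches at each
crossing of `x = lam` (`LowerTrap`); the other case follows by exchanging floor and ceiling
(`gains_one_sub`).

A ball below the slits then stays below them as long as it does not touch them
(`LowerTrap.isBelow_of_no_touch`). At high speed, the product of the relative speed and of the
height of the chamber (`action`) is an adiabatic invariant: away from the crossings it varies by an
amount of the order of the elapsed time, whereas a crossing multiplies it by nearly the quotient
of the heights of the new and the old chamber. In the lower chamber both crossings increase the
height, so the speed of a fast ball grows exponentially (`SpeedConstants.growsExponentially`). In
the upper chamber both crossings decrease it. There a ball can lose its energy, but backwards in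
time it would gain energy exponentially, so that an orbit cannot be fast and in the upper chamber
infinitely often (`SpeedConstants.not_frequently_upward`).

An orbit that starts fast and does not gain energy exponentially hence has a last fast state, after
which it remains in a region of bounded speeds. The set of such states is null by recurrence
(`LowerTrap.ae_not_last_above`): the collision map is injective and preserves the measure with
density `|v - slitVel t|` (`LowerTrap.flux_image`), and modulo the period the region of bounded
speeds has finite measure. Let `M` be the set of the states in this region whose orbits never leave
it, and `W` the set of the states outside it whose orbits enter it at once for good. The collision
map sends `M ∪ W` into `M`, so that `W` is null. Finally, by Sard's theorem almost every state is
followed by a non-degenerate collision (`LowerTrap.ae_mem_nextDomain`), and this holds along the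
whole orbit since the collision map is non-singular.
-/

namespace SlitBilliard

open Topology

/-! ### Folding -/

theorem fold_eq_norm (u : ℝ) : fold u = ‖(u : AddCircle (2 : ℝ))‖ := by
  rw [AddCircle.norm_eq, fold]
  congr 1
  rw [show (2 : ℝ)⁻¹ * u = u / 2 by ring]
  ring

theorem continuous_fold : Continuous fold := by
  have : fold = fun u : ℝ => ‖(u : AddCircle (2 : ℝ))‖ := funext fold_eq_norm
  rw [this]
  exact continuous_norm.comp (AddCircle.continuous_mk' 2)

theorem fold_add_two_mul (u : ℝ) (k : ℤ) : fold (u + 2 * k) = fold u := by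
  rw [fold_eq_norm, fold_eq_norm]
  congr 1
  rw [show u + 2 * (k : ℝ) = u + k • (2 : ℝ) by simp [mul_comm], AddCircle.coe_add]
  have : ((k • (2 : ℝ) : ℝ) : AddCircle (2 : ℝ)) = 0 := by
    rw [AddCircle.coe_zsmul, AddCircle.coe_period, smul_zero]
  rw [this, add_zero]

theorem fold_neg (u : ℝ) : fold (-u) = fold u := by
  rw [fold_eq_norm, fold_eq_norm, AddCircle.coe_neg, norm_neg]

theorem fold_of_abs_le {u : ℝ} (h : |u| ≤ 1) : fold u = |u| := by
  rw [fold_eq_norm, AddCircle.norm_coe_eq_abs_iff _ two_ne_zero]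
  norm_num
  exact h

theorem fold_even {u : ℝ} {k : ℤ} (h1 : 2 * k ≤ u) (h2 : u ≤ 2 * k + 1) : fold u = u - 2 * k := by
  have h := fold_add_two_mul (u - 2 * k) k
  rw [sub_add_cancel] at h
  rw [h, fold_of_abs_le (abs_le.2 ⟨by linarith, by linarith⟩), abs_of_nonneg (by linarith)]

theorem fold_odd {u : ℝ} {k : ℤ} (h1 : 2 * k + 1 ≤ u) (h2 : u ≤ 2 * k + 2) :
    fold u = 2 * k + 2 - u := by
  have h := fold_add_two_mul (u - 2 * (k + 1 : ℤ)) (k + 1)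
  rw [sub_add_cancel] at h
  push_cast at h
  rw [h, fold_of_abs_le (abs_le.2 ⟨by linarith, by linarith⟩), abs_of_nonpos (by linarith)]
  ring

/-- The even one of the two endpoints of the cell `[n, n + 1]`: `fold` is the distance to it on
this cell. -/
noncomputable def cellBase (n : ℤ) : ℝ := if Even n then n else n + 1

theorem neg_one_zpow_sq (n : ℤ) : ((-1 : ℝ) ^ n) * (-1 : ℝ) ^ n = 1 := by
  rw [← zpow_add₀ (by norm_num), Even.neg_one_zpow ⟨n, rfl⟩]

theorem abs_neg_one_zpow' (n : ℤ) : |(-1 : ℝ) ^ n| = 1 := by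
  rw [abs_zpow]; simp

theorem fold_of_cell {u : ℝ} {n : ℤ} (h1 : n ≤ u) (h2 : u ≤ n + 1) :
    fold u = (-1) ^ n * (u - cellBase n) := by
  unfold cellBase
  rcases Int.even_or_odd n with h | h
  · rw [h.neg_one_zpow, if_pos h]
    obtain ⟨k, rfl⟩ := h
    push_cast at *
    rw [fold_even (k := k) (by linarith) (by linarith)]; ring
  · rw [h.neg_one_zpow, if_neg (Int.not_even_iff_odd.2 h)]
    obtain ⟨k, rfl⟩ := h
    push_cast at *
    rw [fold_odd (k := k) (by linarith) (by linarith)]; ring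

theorem eq_of_cell {u : ℝ} {n : ℤ} (h1 : n ≤ u) (h2 : u ≤ n + 1) :
    u = cellBase n + (-1) ^ n * fold u := by
  rw [fold_of_cell h1 h2, ← mul_assoc, neg_one_zpow_sq]; ring

theorem fold_intCast (n : ℤ) : fold n = 0 ∨ fold n = 1 := by
  rcases Int.even_or_odd' n with ⟨k, rfl | rfl⟩
  · left
    push_cast
    rw [fold_even (k := k) (by linarith) (by linarith)]; ring
  · right
    push_cast
    rw [fold_odd (k := k) (by linarith) (by linarith)]; ring

theorem floor_lt_of_fold_mem {u : ℝ} (h : fold u ∈ Ioo (0 : ℝ) 1) : (⌊u⌋ : ℝ) < u := by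
  refine lt_of_le_of_ne (Int.floor_le u) fun he => ?_
  have h0 := fold_intCast ⌊u⌋
  rw [he] at h0
  rcases h0 with h0 | h0
  · exact absurd h.1 (by rw [h0]; exact lt_irrefl _)
  · exact absurd h.2 (by rw [h0]; exact lt_irrefl _)

/-! ### The slits -/

/-- The function that gives the height of the slit above or below the ball at time `t`. -/
noncomputable def slitFn (fL fR : ℝ → ℝ) (lam x₀ t : ℝ) : ℝ → ℝ :=
  if xPos x₀ t < lam then fL else fR

/-- The hypotheses of the theorem in the case where the lower chamber is a trap: at each crossing
of `x = lam`, the slit that the ball leaves is below the slit that it reaches. The horizontal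
position `x₀` at time `0` is an arbitrary point of the unfolded line. -/
structure LowerTrap (fL fR : ℝ → ℝ) (lam x₀ : ℝ) : Prop where
  contDiff_left : ContDiff ℝ 2 fL
  contDiff_right : ContDiff ℝ 2 fR
  periodic_left : Function.Periodic fL 2
  periodic_right : Function.Periodic fR 2
  left_mem : ∀ t, fL t ∈ Ioo (0 : ℝ) 1
  right_mem : ∀ t, fR t ∈ Ioo (0 : ℝ) 1
  lam_pos : 0 < lam
  lam_lt_one : lam < 1
  jump_rightward : fL (lam - x₀) < fR (lam - x₀)
  jump_leftward : fR (2 - lam - x₀) < fL (2 - lam - x₀)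

section

variable {fL fR : ℝ → ℝ} {lam x₀ : ℝ}

theorem slitHeight_eq (t : ℝ) : slitHeight fL fR lam x₀ t = slitFn fL fR lam x₀ t t := by
  unfold slitHeight slitFn; split_ifs <;> rfl

theorem slitVel_eq (t : ℝ) : slitVel fL fR lam x₀ t = deriv (slitFn fL fR lam x₀ t) t := by
  unfold slitVel slitFn; split_ifs <;> rfl

theorem continuous_xPos : Continuous (xPos x₀) :=
  continuous_fold.comp (continuous_const.add continuous_id)

theorem slitFn_cases (t : ℝ) :
    slitFn fL fR lam x₀ t = fL ∨ slitFn fL fR lam x₀ t = fR := by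
  unfold slitFn; split_ifs <;> simp

theorem eventually_slitFn_eq {t : ℝ} (h : xPos x₀ t ≠ lam) :
    ∀ᶠ s in 𝓝 t, xPos x₀ s ≠ lam ∧ slitFn fL fR lam x₀ s = slitFn fL fR lam x₀ t := by
  rcases lt_or_gt_of_ne h with h | h
  · filter_upwards [continuous_xPos.continuousAt.eventually_lt continuousAt_const h] with s hs
    exact ⟨hs.ne, by simp [slitFn, hs, h]⟩
  · filter_upwards [continuousAt_const.eventually_lt continuous_xPos.continuousAt h] with s hs
    exact ⟨hs.ne', by simp [slitFn, hs.le.not_gt, h.le.not_gt]⟩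

theorem touches_iff {s y : ℝ} (h : xPos x₀ s ≠ lam) :
    Touches fL fR lam x₀ s y ↔ y = slitFn fL fR lam x₀ s s := by
  unfold Touches slitFn
  rcases lt_or_gt_of_ne h with h | h
  · simp [h, h.le, h.not_ge]
  · simp [h.le, h.not_gt, h.not_ge]

/-- A ball at height `y` at time `s` is below the slit, and below both slits if it is at the
horizontal position `lam`. -/
def IsBelow (fL fR : ℝ → ℝ) (lam x₀ s y : ℝ) : Prop :=
  (xPos x₀ s ≤ lam → y < fL s) ∧ (lam ≤ xPos x₀ s → y < fR s)

theorem isBelow_iff {s y : ℝ} (h : xPos x₀ s ≠ lam) :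
    IsBelow fL fR lam x₀ s y ↔ y < slitFn fL fR lam x₀ s s := by
  unfold IsBelow slitFn
  rcases lt_or_gt_of_ne h with h | h
  · simp [h, h.le, h.not_ge]
  · simp [h.le, h.not_gt, h.not_ge]

/-- A crossing of `x = lam` from left to right or from right to left. -/
theorem crossing_cases (h0 : 0 < lam) (h1 : lam < 1) {t : ℝ} (h : xPos x₀ t = lam) :
    (∃ k : ℤ, t = 2 * k + (lam - x₀) ∧ ∀ᶠ s in 𝓝[<] t, xPos x₀ s < lam) ∨
    (∃ k : ℤ, t = 2 * k + (2 - lam - x₀) ∧ ∀ᶠ s in 𝓝[<] t, lam < xPos x₀ s) := by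
  have hm : fold (x₀ + t) ∈ Ioo (0 : ℝ) 1 := by
    rw [show fold (x₀ + t) = lam from h]; exact ⟨h0, h1⟩
  have hlt := floor_lt_of_fold_mem hm
  have hlt2 := Int.lt_floor_add_one (x₀ + t)
  set n := ⌊x₀ + t⌋ with hn
  have hcell := eq_of_cell hlt.le hlt2.le
  rw [show fold (x₀ + t) = lam from h] at hcell
  have hev : ∀ᶠ s in 𝓝[<] t, (n : ℝ) ≤ x₀ + s ∧ x₀ + s ≤ n + 1 ∧ s < t := by
    have e1 : ∀ᶠ s in 𝓝[<] t, (n : ℝ) < x₀ + s :=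
      (continuousAt_const.eventually_lt
        (by fun_prop : ContinuousAt (fun s => x₀ + s) t) hlt).filter_mono nhdsWithin_le_nhds
    filter_upwards [e1, self_mem_nhdsWithin] with s h1 h2
    exact ⟨h1.le, by have := mem_Iio.1 h2; linarith, h2⟩
  rcases Int.even_or_odd n with he | ho
  · left
    rw [he.neg_one_zpow, cellBase, if_pos he] at hcell
    obtain ⟨k, hk⟩ := he
    refine ⟨k, by rw [hk] at hcell; push_cast at hcell; linarith, ?_⟩
    filter_upwards [hev] with s hs
    rw [xPos, fold_of_cell hs.1 hs.2.1, Even.neg_one_zpow ⟨k, hk⟩, cellBase, if_pos ⟨k, hk⟩]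
    linarith [hs.2.2]
  · right
    rw [ho.neg_one_zpow, cellBase, if_neg (Int.not_even_iff_odd.2 ho)] at hcell
    have ho' := ho
    obtain ⟨k, hk⟩ := ho
    refine ⟨k, by rw [hk] at hcell; push_cast at hcell; linarith, ?_⟩
    filter_upwards [hev] with s hs
    rw [xPos, fold_of_cell hs.1 hs.2.1, ho'.neg_one_zpow, cellBase,
      if_neg (Int.not_even_iff_odd.2 ho')]
    linarith [hs.2.2]

theorem periodic_two_mul {f : ℝ → ℝ} (hf : Function.Periodic f 2) (k : ℤ) (t : ℝ) :
    f (2 * k + t) = f t := by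
  have := hf.int_mul k t
  rw [← this]; congr 1; ring

namespace LowerTrap

variable (H : LowerTrap fL fR lam x₀)
include H

theorem contDiff_slitFn (t : ℝ) : ContDiff ℝ 2 (slitFn fL fR lam x₀ t) := by
  rcases slitFn_cases (fL := fL) (fR := fR) (lam := lam) (x₀ := x₀) t with h | h <;> rw [h]
  exacts [H.contDiff_left, H.contDiff_right]

theorem slitFn_mem (t s : ℝ) : slitFn fL fR lam x₀ t s ∈ Ioo (0 : ℝ) 1 := by
  rcases slitFn_cases (fL := fL) (fR := fR) (lam := lam) (x₀ := x₀) t with h | h <;> rw [h]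
  exacts [H.left_mem s, H.right_mem s]

theorem touches_mem {s y : ℝ} (h : Touches fL fR lam x₀ s y) : y ∈ Ioo (0 : ℝ) 1 := by
  rcases h with ⟨-, rfl⟩ | ⟨-, rfl⟩
  exacts [H.left_mem s, H.right_mem s]

theorem isBelow_zero (s : ℝ) : IsBelow fL fR lam x₀ s 0 :=
  ⟨fun _ => (H.left_mem s).1, fun _ => (H.right_mem s).1⟩

theorem not_isBelow_one (s : ℝ) : ¬ IsBelow fL fR lam x₀ s 1 := by
  intro h
  rcases le_total (xPos x₀ s) lam with h' | h'
  · exact absurd (h.1 h') (H.left_mem s).2.le.not_gt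
  · exact absurd (h.2 h') (H.right_mem s).2.le.not_gt

theorem jump {t : ℝ} (h : xPos x₀ t = lam) :
    (fL t < fR t ∧ ∀ᶠ s in 𝓝[<] t, xPos x₀ s < lam) ∨
    (fR t < fL t ∧ ∀ᶠ s in 𝓝[<] t, lam < xPos x₀ s) := by
  rcases crossing_cases H.lam_pos H.lam_lt_one h with ⟨k, hk, he⟩ | ⟨k, hk, he⟩
  · refine Or.inl ⟨?_, he⟩
    rw [hk, periodic_two_mul H.periodic_left, periodic_two_mul H.periodic_right]
    exact H.jump_rightward
  · refine Or.inr ⟨?_, he⟩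
    rw [hk, periodic_two_mul H.periodic_left, periodic_two_mul H.periodic_right]
    exact H.jump_leftward

theorem isClosed_touches :
    IsClosed {z : ℝ × ℝ | Touches fL fR lam x₀ z.1 z.2} := by
  have hL := H.contDiff_left.continuous
  have hR := H.contDiff_right.continuous
  have hx := continuous_xPos (x₀ := x₀)
  have h1 := (isClosed_le (f := fun z : ℝ × ℝ => xPos x₀ z.1) (g := fun _ => lam) (by fun_prop)
    (by fun_prop)).inter (isClosed_eq (f := fun z : ℝ × ℝ => z.2) (g := fun z => fL z.1)
    (by fun_prop) (by fun_prop))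
  have h2 := (isClosed_le (f := fun _ : ℝ × ℝ => lam) (g := fun z => xPos x₀ z.1) (by fun_prop)
    (by fun_prop)).inter (isClosed_eq (f := fun z : ℝ × ℝ => z.2) (g := fun z => fR z.1)
    (by fun_prop) (by fun_prop))
  exact h1.union h2

/-- A ball that is below the slits stays below them as long as it does not touch them: the slit
over the ball jumps upwards at the crossings of `x = lam`. -/
theorem isBelow_of_no_touch {y : ℝ → ℝ} (hy : Continuous y) {a b : ℝ} (hab : a ≤ b)
    (ha : IsBelow fL fR lam x₀ a (y a))
    (hno : ∀ s ∈ Icc a b, ¬ Touches fL fR lam x₀ s (y s)) : IsBelow fL fR lam x₀ b (y b) := by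
  have hL := H.contDiff_left.continuous
  have hR := H.contDiff_right.continuous
  have hx := continuous_xPos (x₀ := x₀)
  by_contra hb
  have hcl : IsClosed {s | ¬ IsBelow fL fR lam x₀ s (y s)} := by
    have : {s | ¬ IsBelow fL fR lam x₀ s (y s)} =
        ({s | xPos x₀ s ≤ lam} ∩ {s | fL s ≤ y s}) ∪ ({s | lam ≤ xPos x₀ s} ∩ {s | fR s ≤ y s}) := by
      ext s
      simp only [IsBelow, mem_ofPred_eq, mem_union, mem_inter_iff]
      constructor
      · intro h
        by_contra h'
        push Not at h'
        exact h h'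
      · rintro (h | h) h'
        · exact absurd (h'.1 h.1) h.2.not_gt
        · exact absurd (h'.2 h.1) h.2.not_gt
    rw [this]
    exact ((isClosed_le hx continuous_const).inter (isClosed_le hL hy)).union
      ((isClosed_le continuous_const hx).inter (isClosed_le hR hy))
  obtain ⟨m, ⟨⟨hma, hmb⟩, hm⟩, hmin⟩ :=
    (isCompact_Icc.inter_right hcl : IsCompact (Icc a b ∩ _)).exists_isLeast
      ⟨b, ⟨hab, le_rfl⟩, hb⟩
  have ham : a < m := lt_of_le_of_ne hma fun h => hm (h ▸ ha)
  have hbelow : ∀ᶠ s in 𝓝[<] m, IsBelow fL fR lam x₀ s (y s) := by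
    have : ∀ᶠ s in 𝓝[<] m, a < s := (lt_mem_nhds ham).filter_mono nhdsWithin_le_nhds
    filter_upwards [this, self_mem_nhdsWithin] with s h1 h2
    by_contra h3
    exact absurd (hmin ⟨⟨h1.le, (mem_Iio.1 h2).le.trans hmb⟩, h3⟩) (not_le.2 h2)
  have hlim : ∀ f : ℝ → ℝ, Continuous f → (∀ᶠ s in 𝓝[<] m, y s < f s) → y m ≤ f m := by
    intro f hf hev
    exact le_of_tendsto_of_tendsto (hy.continuousAt.mono_left nhdsWithin_le_nhds)
      (hf.continuousAt.mono_left nhdsWithin_le_nhds) (hev.mono fun s h => h.le)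
  have key1 : (∀ᶠ s in 𝓝[<] m, xPos x₀ s < lam) → y m ≤ fL m := fun h =>
    hlim fL hL (by filter_upwards [h, hbelow] with s h1 h2 using h2.1 h1.le)
  have key2 : (∀ᶠ s in 𝓝[<] m, lam < xPos x₀ s) → y m ≤ fR m := fun h =>
    hlim fR hR (by filter_upwards [h, hbelow] with s h1 h2 using h2.2 h1.le)
  have hmt := hno m ⟨hma, hmb⟩
  unfold Touches at hmt
  push Not at hmt
  apply hm
  rcases lt_trichotomy (xPos x₀ m) lam with h | h | h
  · have := key1 ((hx.continuousAt.eventually_lt continuousAt_const h).filter_mono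
      nhdsWithin_le_nhds)
    exact ⟨fun h' => lt_of_le_of_ne this (hmt.1 h'), fun h' => absurd h h'.not_gt⟩
  · have h1 := hmt.1 h.le
    have h2 := hmt.2 h.ge
    rcases H.jump h with ⟨hj, he⟩ | ⟨hj, he⟩
    · have := lt_of_le_of_ne (key1 he) h1
      exact ⟨fun _ => this, fun _ => this.trans hj⟩
    · have := lt_of_le_of_ne (key2 he) h2
      exact ⟨fun _ => this.trans hj, fun _ => this⟩
  · have := key2 ((continuousAt_const.eventually_lt hx.continuousAt h).filter_mono
      nhdsWithin_le_nhds)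
    exact ⟨fun h' => absurd h h'.not_gt, fun h' => lt_of_le_of_ne this (hmt.2 h')⟩

end LowerTrap

end

/-! ### The collision map -/

/-- The non-degenerate collision states that are followed by a non-degenerate collision: the domain
of the collision map. -/
def nextDomain (fL fR : ℝ → ℝ) (lam x₀ : ℝ) : Set (ℝ × ℝ) :=
  {p | IsCollisionState fL fR lam x₀ p ∧
    ∃ q, IsNextCollision fL fR lam x₀ p q ∧ IsCollisionState fL fR lam x₀ q}

open Classical in
/-- The collision map, extended by the identity outside of `nextDomain`. -/
noncomputable def collisionMap (fL fR : ℝ → ℝ) (lam x₀ : ℝ) (p : ℝ × ℝ) : ℝ × ℝ :=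
  if h : p ∈ nextDomain fL fR lam x₀ then h.2.choose else p

section

variable {fL fR : ℝ → ℝ} {lam x₀ : ℝ}

theorem collisionMap_spec {p : ℝ × ℝ} (hp : p ∈ nextDomain fL fR lam x₀) :
    IsNextCollision fL fR lam x₀ p (collisionMap fL fR lam x₀ p) ∧
      IsCollisionState fL fR lam x₀ (collisionMap fL fR lam x₀ p) := by
  unfold collisionMap
  rw [dif_pos hp]
  exact hp.2.choose_spec

theorem collisionMap_eq {p q : ℝ × ℝ} (hp : IsCollisionState fL fR lam x₀ p)
    (hpq : IsNextCollision fL fR lam x₀ p q) (hq : IsCollisionState fL fR lam x₀ q) :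
    p ∈ nextDomain fL fR lam x₀ ∧ collisionMap fL fR lam x₀ p = q :=
  have h : p ∈ nextDomain fL fR lam x₀ := ⟨hp, q, hpq, hq⟩
  ⟨h, (collisionMap_spec h).1.unique hpq⟩

theorem unfolded_eq (p : ℝ × ℝ) (s : ℝ) : unfolded fL fR lam x₀ p s =
    slitFn fL fR lam x₀ p.1 p.1 + p.2 * (s - p.1) := by
  rw [unfolded, slitHeight_eq]

theorem continuous_unfolded (p : ℝ × ℝ) : Continuous (unfolded fL fR lam x₀ p) := by
  unfold unfolded; fun_prop

theorem continuous_flightHeight (p : ℝ × ℝ) : Continuous (flightHeight fL fR lam x₀ p) :=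
  continuous_fold.comp (continuous_unfolded p)

theorem exists_sign_change {φ : ℝ → ℝ} {c s δ : ℝ} (h : HasDerivAt φ c s) (h0 : φ s = 0)
    (hc : c ≠ 0) (hδ : 0 < δ) :
    ∃ a ∈ Ioo (s - δ) s, ∃ b ∈ Ioo s (s + δ), φ a * φ b < 0 := by
  have h1 := hasDerivAt_iff_tendsto_slope.1 h
  have h2 : ∀ᶠ z in 𝓝[≠] s, 0 < slope φ s z * c := by
    refine (h1.mul_const c).eventually_const_lt ?_
    exact mul_self_pos.2 hc
  have h3 : ∀ᶠ z in 𝓝[<] s, 0 < slope φ s z * c :=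
    h2.filter_mono (nhdsWithin_mono _ fun z hz => (mem_Iio.1 hz).ne)
  have h4 : ∀ᶠ z in 𝓝[>] s, 0 < slope φ s z * c :=
    h2.filter_mono (nhdsWithin_mono _ fun z hz => (mem_Ioi.1 hz).ne')
  obtain ⟨a, ha1, ha2⟩ := (h3.and (Ioo_mem_nhdsLT (show s - δ < s by linarith))).exists
  obtain ⟨b, hb1, hb2⟩ := (h4.and (Ioo_mem_nhdsGT (show s < s + δ by linarith))).exists
  refine ⟨a, ha2, b, hb2, ?_⟩
  have ea : φ a = slope φ s a * (a - s) := by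
    rw [slope_def_field, h0, sub_zero, div_mul_cancel₀ _ (by linarith [ha2.2])]
  have eb : φ b = slope φ s b * (b - s) := by
    rw [slope_def_field, h0, sub_zero, div_mul_cancel₀ _ (by linarith [hb2.1])]
  have hpos : 0 < slope φ s a * slope φ s b := by
    have := mul_pos ha1 hb1
    have e : slope φ s a * c * (slope φ s b * c) = (slope φ s a * slope φ s b) * c ^ 2 := by ring
    rw [e] at this
    exact pos_of_mul_pos_left this (sq_nonneg c)
  rw [ea, eb]
  have h5 : 0 < (s - a) * (b - s) := mul_pos (by linarith [ha2.2]) (by linarith [hb2.1])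
  nlinarith [mul_pos hpos h5]

theorem next_unfolded {p q : ℝ × ℝ} (h : IsNextCollision fL fR lam x₀ p q)
    (hx : xPos x₀ q.1 ≠ lam) :
    unfolded fL fR lam x₀ p q.1 = cellBase ⌊unfolded fL fR lam x₀ p q.1⌋ +
      (-1) ^ ⌊unfolded fL fR lam x₀ p q.1⌋ * slitFn fL fR lam x₀ q.1 q.1 := by
  have h1 := eq_of_cell (Int.floor_le (unfolded fL fR lam x₀ p q.1)) (Int.lt_floor_add_one _).le
  rwa [show fold (unfolded fL fR lam x₀ p q.1) = slitFn fL fR lam x₀ q.1 q.1 from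
    (touches_iff hx).1 h.2.2.1] at h1

namespace LowerTrap

variable (H : LowerTrap fL fR lam x₀)
include H

theorem continuous_deriv_slitFn (t : ℝ) : Continuous (deriv (slitFn fL fR lam x₀ t)) :=
  (H.contDiff_slitFn t).continuous_deriv (by norm_num)

theorem differentiable_slitFn (t : ℝ) : Differentiable ℝ (slitFn fL fR lam x₀ t) :=
  (H.contDiff_slitFn t).differentiable (by norm_num)

theorem isOpen_collisionState : IsOpen {p | IsCollisionState fL fR lam x₀ p} := by
  rw [isOpen_iff_mem_nhds]
  intro p hp
  have h1 : ∀ᶠ z : ℝ × ℝ in 𝓝 p, xPos x₀ z.1 ≠ lam ∧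
      slitFn fL fR lam x₀ z.1 = slitFn fL fR lam x₀ p.1 :=
    continuous_fst.continuousAt.eventually (eventually_slitFn_eq hp.1)
  have h2 : ∀ᶠ z : ℝ × ℝ in 𝓝 p, z.2 ≠ deriv (slitFn fL fR lam x₀ p.1) z.1 := by
    have := hp.2
    rw [slitVel_eq] at this
    exact (isOpen_ne_fun continuous_snd
      ((H.continuous_deriv_slitFn p.1).comp continuous_fst)).mem_nhds this
  filter_upwards [h1, h2] with z hz1 hz2
  exact ⟨hz1.1, by rw [slitVel_eq, hz1.2]; exact hz2⟩

/-- There is no collision shortly after a non-degenerate one, uniformly in the initial state. -/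
theorem exists_no_touch_start {p₀ : ℝ × ℝ} (hp₀ : IsCollisionState fL fR lam x₀ p₀) :
    ∃ ε > 0, ∀ᶠ p : ℝ × ℝ in 𝓝 p₀, ∀ s ∈ Ioc p.1 (p₀.1 + ε),
      ¬ Touches fL fR lam x₀ s (flightHeight fL fR lam x₀ p s) := by
  set f := slitFn fL fR lam x₀ p₀.1 with hf
  have hfc : Continuous f := (H.contDiff_slitFn p₀.1).continuous
  have hfd : Continuous (deriv f) := H.continuous_deriv_slitFn p₀.1
  have h1 : ∀ᶠ z : (ℝ × ℝ) × ℝ in 𝓝 (p₀, p₀.1), xPos x₀ z.2 ≠ lam ∧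
      slitFn fL fR lam x₀ z.2 = f :=
    continuous_snd.continuousAt.eventually (eventually_slitFn_eq hp₀.1)
  have h2 : ∀ᶠ z : (ℝ × ℝ) × ℝ in 𝓝 (p₀, p₀.1), z.1.2 ≠ deriv f z.2 := by
    have := hp₀.2
    rw [slitVel_eq] at this
    exact (isOpen_ne_fun (f := fun z : (ℝ × ℝ) × ℝ => z.1.2) (g := fun z => deriv f z.2)
      (by fun_prop) (by fun_prop)).mem_nhds this
  have h3 : ∀ᶠ z : (ℝ × ℝ) × ℝ in 𝓝 (p₀, p₀.1),
      f z.1.1 + z.1.2 * (z.2 - z.1.1) ∈ Ioo (0 : ℝ) 1 := by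
    have hc : ContinuousAt (fun z : (ℝ × ℝ) × ℝ => f z.1.1 + z.1.2 * (z.2 - z.1.1)) (p₀, p₀.1) := by
      fun_prop
    refine hc.eventually (isOpen_Ioo.mem_nhds ?_)
    simpa using H.slitFn_mem p₀.1 p₀.1
  obtain ⟨r, hr, hball⟩ := Metric.eventually_nhds_iff.1 (h1.and (h2.and h3))
  refine ⟨r / 2, by linarith, ?_⟩
  filter_upwards [Metric.ball_mem_nhds p₀ hr] with p hp s hs ht
  have hp' : dist p p₀ < r := hp
  have hp1 : |p.1 - p₀.1| < r := by
    have := le_max_left (dist p.1 p₀.1) (dist p.2 p₀.2)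
    rw [← Prod.dist_eq, Real.dist_eq] at this
    linarith
  rw [abs_lt] at hp1
  have hA : ∀ ξ ∈ Icc p.1 s, dist (p, ξ) (p₀, p₀.1) < r := by
    intro ξ hξ
    rw [Prod.dist_eq]
    refine max_lt hp' ?_
    rw [Real.dist_eq, abs_lt]
    constructor <;> linarith [hξ.1, hξ.2, hs.1, hs.2]
  have hBs := hball (hA s ⟨hs.1.le, le_rfl⟩)
  have hBp := hball (hA p.1 ⟨le_rfl, hs.1.le⟩)
  have hs1 := hBs.1
  have hp2 := hBp.1
  have hU := hBs.2.2
  simp only at hs1 hp2 hU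
  rw [touches_iff hs1.1, hs1.2, flightHeight, unfolded_eq, hp2.2,
    fold_of_abs_le (abs_le.2 ⟨by linarith [hU.1], hU.2.le⟩), abs_of_pos hU.1] at ht
  obtain ⟨ξ, hξ, hξ'⟩ := exists_deriv_eq_slope f hs.1 hfc.continuousOn
    (H.differentiable_slitFn p₀.1).differentiableOn
  refine (hball (hA ξ ⟨hξ.1.le, hξ.2.le⟩)).2.1 ?_
  simp only
  rw [hξ', eq_div_iff (by linarith [hs.1]), ← ht]
  ring

/-- If a ball touches a slit after a non-degenerate collision, there is a first such time. -/
theorem exists_next_of_touch {p : ℝ × ℝ} (hp : IsCollisionState fL fR lam x₀ p) {s : ℝ}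
    (hs : p.1 < s) (ht : Touches fL fR lam x₀ s (flightHeight fL fR lam x₀ p s)) :
    ∃ q, IsNextCollision fL fR lam x₀ p q ∧ q.1 ≤ s := by
  obtain ⟨ε, hε, hev⟩ := H.exists_no_touch_start hp
  have hno := hev.self_of_nhds
  have hεs : p.1 + ε < s := by
    by_contra h
    exact hno s ⟨hs, not_lt.1 h⟩ ht
  have hcl : IsClosed {s | Touches fL fR lam x₀ s (flightHeight fL fR lam x₀ p s)} :=
    H.isClosed_touches.preimage (continuous_id.prodMk (continuous_flightHeight p))
  obtain ⟨m, ⟨⟨hm1, hm2⟩, hm3⟩, hmin⟩ :=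
    (isCompact_Icc.inter_right hcl : IsCompact (Icc (p.1 + ε) s ∩ _)).exists_isLeast
      ⟨s, ⟨hεs.le, le_rfl⟩, ht⟩
  refine ⟨(m, 2 * slitVel fL fR lam x₀ m - flightVel fL fR lam x₀ p m),
    ⟨by simp only; linarith, ?_, hm3, rfl⟩, hm2⟩
  intro z hz hzt
  rcases le_or_gt z (p.1 + ε) with h | h
  · exact hno z ⟨hz.1, h⟩ hzt
  · exact absurd (hmin ⟨⟨h.le, hz.2.le.trans hm2⟩, hzt⟩) (not_le.2 hz.2)

theorem exists_touch_of_zero_of_one {y : ℝ → ℝ} (hy : Continuous y) {a b : ℝ} (hab : a ≤ b)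
    (ha : y a = 0) (hb : y b = 1) : ∃ s ∈ Icc a b, Touches fL fR lam x₀ s (y s) := by
  by_contra hno
  push Not at hno
  have := H.isBelow_of_no_touch hy hab (by rw [ha]; exact H.isBelow_zero a) hno
  rw [hb] at this
  exact H.not_isBelow_one b this

/-- A ball that moves vertically meets a slit again: on its way from the floor to the ceiling it
has to. -/
theorem exists_next {p : ℝ × ℝ} (hp : IsCollisionState fL fR lam x₀ p) (hv : p.2 ≠ 0) :
    ∃ q, IsNextCollision fL fR lam x₀ p q := by
  have hm := H.slitFn_mem p.1 p.1
  have key : ∀ a b : ℝ, p.1 < a → a ≤ b → flightHeight fL fR lam x₀ p a = 0 →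
      flightHeight fL fR lam x₀ p b = 1 → ∃ q, IsNextCollision fL fR lam x₀ p q := by
    intro a b ha hab h0 h1
    obtain ⟨s, hs, ht⟩ := H.exists_touch_of_zero_of_one (continuous_flightHeight p) hab h0 h1
    obtain ⟨q, hq, -⟩ := H.exists_next_of_touch hp (ha.trans_le hs.1) ht
    exact ⟨q, hq⟩
  set h := slitFn fL fR lam x₀ p.1 p.1 with hh
  have hU : ∀ c : ℝ, unfolded fL fR lam x₀ p (p.1 + (c - h) / p.2) = c := by
    intro c
    rw [unfolded_eq]
    field_simp
    ring
  rcases lt_or_gt_of_ne hv with hv | hv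
  · refine key (p.1 + (0 - h) / p.2) (p.1 + (-1 - h) / p.2) ?_ ?_ ?_ ?_
    · have : 0 < (0 - h) / p.2 := div_pos_of_neg_of_neg (by linarith [hm.1]) hv
      linarith
    · have := div_le_div_of_nonpos_of_le hv.le (show -1 - h ≤ 0 - h by linarith)
      linarith
    · rw [flightHeight, hU, fold_of_abs_le (by simp)]; simp
    · rw [flightHeight, hU, fold_of_abs_le (by simp)]; simp
  · refine key (p.1 + (2 - h) / p.2) (p.1 + (3 - h) / p.2) ?_ ?_ ?_ ?_
    · have : 0 < (2 - h) / p.2 := div_pos (by linarith [hm.2]) hv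
      linarith
    · have := div_le_div_of_nonneg_right (show 2 - h ≤ 3 - h by linarith) hv.le
      linarith
    · rw [flightHeight, hU, fold_even (k := 1) (by norm_num) (by norm_num)]; norm_num
    · rw [flightHeight, hU, fold_even (k := 1) (by norm_num) (by norm_num)]; norm_num

theorem next_floor_lt {p q : ℝ × ℝ} (h : IsNextCollision fL fR lam x₀ p q) :
    (⌊unfolded fL fR lam x₀ p q.1⌋ : ℝ) < unfolded fL fR lam x₀ p q.1 :=
  floor_lt_of_fold_mem (H.touches_mem h.2.2.1)

/-- The next collision depends continuously on the state, near a state that is followed by a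
non-degenerate collision: such a collision is transversal, hence it persists, and the absence of
collisions on a compact time interval before it persists too. -/
theorem eventually_next {p₀ q₀ : ℝ × ℝ} (hp₀ : IsCollisionState fL fR lam x₀ p₀)
    (hpq : IsNextCollision fL fR lam x₀ p₀ q₀) (hq₀ : IsCollisionState fL fR lam x₀ q₀) {δ : ℝ}
    (hδ : 0 < δ) :
    ∀ᶠ p in 𝓝 p₀, ∃ q, IsNextCollision fL fR lam x₀ p q ∧ |q.1 - q₀.1| < δ ∧
      q.2 = 2 * deriv (slitFn fL fR lam x₀ q₀.1) q.1 -
        (-1) ^ ⌊unfolded fL fR lam x₀ p₀ q₀.1⌋ * p.2 := by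
  set f := slitFn fL fR lam x₀ p₀.1 with hf
  have hfc : Continuous f := (H.contDiff_slitFn p₀.1).continuous
  set g := slitFn fL fR lam x₀ q₀.1 with hg
  have hgc : Continuous g := (H.contDiff_slitFn q₀.1).continuous
  set n := ⌊unfolded fL fR lam x₀ p₀ q₀.1⌋ with hn
  set s₀ := q₀.1 with hs₀
  have ht₀ := hpq.1
  -- the flight lines, with the slit at the start fixed
  set F : (ℝ × ℝ) × ℝ → ℝ := fun z => f z.1.1 + z.1.2 * (z.2 - z.1.1) with hF
  have hFc : Continuous F := by fun_prop
  have hside : ∀ᶠ p : ℝ × ℝ in 𝓝 p₀, ∀ s, unfolded fL fR lam x₀ p s = F (p, s) := by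
    have : ∀ᶠ p : ℝ × ℝ in 𝓝 p₀, xPos x₀ p.1 ≠ lam ∧ slitFn fL fR lam x₀ p.1 = f :=
      continuous_fst.continuousAt.eventually (eventually_slitFn_eq hp₀.1)
    filter_upwards [this] with p hp s
    rw [unfolded_eq, hp.2]
  have hside₀ := hside.self_of_nhds
  have hcell : ∀ᶠ z : (ℝ × ℝ) × ℝ in 𝓝 (p₀, s₀), (n : ℝ) < F z ∧ F z < n + 1 := by
    have h1 := H.next_floor_lt hpq
    have h2 := Int.lt_floor_add_one (unfolded fL fR lam x₀ p₀ s₀)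
    rw [hside₀] at h1 h2
    exact (continuousAt_const.eventually_lt hFc.continuousAt
      (by rw [hn, ← hside₀ s₀] at *; exact h1)).and
      (hFc.continuousAt.eventually_lt continuousAt_const
      (by rw [hn, ← hside₀ s₀] at *; exact h2))
  have hslit : ∀ᶠ z : (ℝ × ℝ) × ℝ in 𝓝 (p₀, s₀), xPos x₀ z.2 ≠ lam ∧
      slitFn fL fR lam x₀ z.2 = g :=
    continuous_snd.continuousAt.eventually (eventually_slitFn_eq hq₀.1)
  obtain ⟨r, hr, hball⟩ := Metric.eventually_nhds_iff.1 (hcell.and hslit)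
  -- the sign change at the transversal collision
  have hderiv : HasDerivAt (fun s => F (p₀, s) - (cellBase n + (-1) ^ n * g s))
      (p₀.2 - (-1) ^ n * deriv g s₀) s₀ := by
    have h1 : HasDerivAt (fun s => F (p₀, s)) p₀.2 s₀ := by
      have := (((hasDerivAt_id s₀).sub_const p₀.1).const_mul p₀.2).const_add (f p₀.1)
      simpa [hF] using this
    have h2 := ((H.differentiable_slitFn q₀.1 s₀).hasDerivAt.const_mul ((-1 : ℝ) ^ n)).const_add
      (cellBase n)
    exact h1.sub h2
  have hzero : F (p₀, s₀) - (cellBase n + (-1) ^ n * g s₀) = 0 := by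
    have := next_unfolded hpq hq₀.1
    rw [hside₀, ← hside₀, ← hn, hside₀] at this
    linarith
  have htrans : p₀.2 - (-1) ^ n * deriv g s₀ ≠ 0 := by
    intro h
    apply hq₀.2
    rw [hpq.2.2.2, slitVel_eq, flightVel, ← hs₀, ← hn, ← hg]
    have : p₀.2 = (-1) ^ n * deriv g s₀ := by linarith
    rw [this, ← mul_assoc, neg_one_zpow_sq]
    ring
  obtain ⟨a, ha, b, hb, hab⟩ := exists_sign_change hderiv hzero htrans
    (show 0 < min (min δ r) (s₀ - p₀.1) from
      lt_min (lt_min hδ hr) (by linarith))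
  have hm1 : min (min δ r) (s₀ - p₀.1) ≤ δ := (min_le_left _ _).trans (min_le_left _ _)
  have hm2 : min (min δ r) (s₀ - p₀.1) ≤ r := (min_le_left _ _).trans (min_le_right _ _)
  have hm3 : min (min δ r) (s₀ - p₀.1) ≤ s₀ - p₀.1 := min_le_right _ _
  obtain ⟨ε, hε, hstart⟩ := H.exists_no_touch_start hp₀
  have hmid : ∀ᶠ p : ℝ × ℝ in 𝓝 p₀, ∀ s ∈ Icc (p₀.1 + ε) a,
      ¬ Touches fL fR lam x₀ s (fold (F (p, s))) := by
    refine isCompact_Icc.eventually_forall_of_forall_eventually fun s hs => ?_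
    have hno := hpq.2.1 s ⟨by linarith [hs.1], hs.2.trans_lt ha.2⟩
    rw [flightHeight, hside₀] at hno
    have hop : IsOpen {z : (ℝ × ℝ) × ℝ | ¬ Touches fL fR lam x₀ z.2 (fold (F z))} :=
      (H.isClosed_touches.preimage
        (continuous_snd.prodMk (continuous_fold.comp hFc))).isOpen_compl
    exact hop.mem_nhds hno
  have hsign : ∀ᶠ p : ℝ × ℝ in 𝓝 p₀,
      (F (p, a) - (cellBase n + (-1) ^ n * g a)) * (F (p, b) - (cellBase n + (-1) ^ n * g b)) < 0 :=
    ContinuousAt.eventually_lt (by fun_prop) continuousAt_const hab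
  have hlt : ∀ᶠ p : ℝ × ℝ in 𝓝 p₀, p.1 < a :=
    continuous_fst.continuousAt.eventually_lt continuousAt_const (by linarith [ha.1])
  filter_upwards [hside, hstart, hmid, hsign, hlt, H.isOpen_collisionState.mem_nhds hp₀,
    Metric.ball_mem_nhds p₀ hr] with p hp hpstart hpmid hpsign hpa hpc hpr
  have hnear : ∀ s ∈ Icc a b, dist (p, s) (p₀, s₀) < r := by
    intro s hs
    rw [Prod.dist_eq]
    refine max_lt hpr ?_
    rw [Real.dist_eq, abs_lt]
    constructor <;> linarith [hs.1, hs.2, ha.1, hb.2]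
  have htouch : ∃ s ∈ Icc a b, Touches fL fR lam x₀ s (flightHeight fL fR lam x₀ p s) := by
    have hc : ContinuousOn (fun s => F (p, s) - (cellBase n + (-1) ^ n * g s)) (Icc a b) := by
      fun_prop
    have hab' : a ≤ b := (ha.2.trans hb.1).le
    have h0 : ∃ s ∈ Icc a b, F (p, s) - (cellBase n + (-1) ^ n * g s) = 0 := by
      rcases mul_neg_iff.1 hpsign with h | h
      · exact intermediate_value_Icc' hab' hc ⟨h.2.le, h.1.le⟩
      · exact intermediate_value_Icc hab' hc ⟨h.1.le, h.2.le⟩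
    obtain ⟨s, hs, h0⟩ := h0
    have hB := hball (hnear s hs)
    refine ⟨s, hs, ?_⟩
    rw [touches_iff hB.2.1, flightHeight, hp, hB.2.2, fold_of_cell hB.1.1.le hB.1.2.le,
      show F (p, s) - cellBase n = (-1) ^ n * g s by linarith, ← mul_assoc, neg_one_zpow_sq,
      one_mul]
  obtain ⟨s, hs, ht⟩ := htouch
  obtain ⟨q, hq, hqs⟩ := H.exists_next_of_touch hpc (hpa.trans_le hs.1) ht
  have hqa : a < q.1 := by
    by_contra h
    push Not at h
    have hqt := hq.2.2.1
    rcases le_or_gt q.1 (p₀.1 + ε) with h' | h'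
    · exact hpstart q.1 ⟨hq.1, h'⟩ hqt
    · rw [flightHeight, hp] at hqt
      exact hpmid q.1 ⟨h'.le, h⟩ hqt
  refine ⟨q, hq, ?_, ?_⟩
  · rw [abs_lt]
    constructor <;> linarith [hs.2, ha.1, hb.2]
  · have hB := hball (hnear q.1 ⟨hqa.le, hqs.trans hs.2⟩)
    have hfl : ⌊unfolded fL fR lam x₀ p q.1⌋ = n := by
      rw [hp, Int.floor_eq_iff]
      exact ⟨hB.1.1.le, hB.1.2⟩
    have hsl := hB.2.2
    simp only at hsl
    rw [hq.2.2.2, slitVel_eq, flightVel, hfl, hsl]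

theorem continuousAt_collisionMap {p₀ : ℝ × ℝ} (hp₀ : p₀ ∈ nextDomain fL fR lam x₀) :
    nextDomain fL fR lam x₀ ∈ 𝓝 p₀ ∧ ContinuousAt (collisionMap fL fR lam x₀) p₀ := by
  obtain ⟨hpq, hq⟩ := collisionMap_spec hp₀
  set q₀ := collisionMap fL fR lam x₀ p₀ with hq₀
  set n := ⌊unfolded fL fR lam x₀ p₀ q₀.1⌋ with hn
  set R : (ℝ × ℝ) × ℝ → ℝ × ℝ := fun z =>
    (z.2, 2 * deriv (slitFn fL fR lam x₀ q₀.1) z.2 - (-1) ^ n * z.1.2) with hR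
  have hRc : Continuous R := by
    have := H.continuous_deriv_slitFn q₀.1
    fun_prop
  have hR₀ : R (p₀, q₀.1) = q₀ := by
    have := hpq.2.2.2
    rw [slitVel_eq, flightVel, ← hn] at this
    exact Prod.ext rfl this.symm
  have key : ∀ U ∈ 𝓝 q₀, ∀ᶠ p in 𝓝 p₀, ∃ q ∈ U, IsNextCollision fL fR lam x₀ p q := by
    intro U hU
    have h1 : ∀ᶠ z in 𝓝 (p₀, q₀.1), R z ∈ U := hRc.continuousAt.eventually (by rwa [hR₀])
    obtain ⟨r, hr, hball⟩ := Metric.eventually_nhds_iff.1 h1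
    filter_upwards [H.eventually_next hp₀.1 hpq hq hr, Metric.ball_mem_nhds p₀ hr] with p hp hpr
    obtain ⟨q, hq1, hq2, hq3⟩ := hp
    refine ⟨q, ?_, hq1⟩
    have : R (p, q.1) ∈ U := hball (by
      rw [Prod.dist_eq]; exact max_lt hpr (by rwa [Real.dist_eq]))
    rwa [show R (p, q.1) = q from Prod.ext rfl hq3.symm] at this
  have hC := H.isOpen_collisionState
  have key2 : ∀ U ∈ 𝓝 q₀, ∀ᶠ p in 𝓝 p₀, p ∈ nextDomain fL fR lam x₀ ∧
      collisionMap fL fR lam x₀ p ∈ U := by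
    intro U hU
    filter_upwards [key _ (inter_mem hU (hC.mem_nhds hq)), hC.mem_nhds hp₀.1] with p hp hpc
    obtain ⟨q, hq1, hq2⟩ := hp
    obtain ⟨h1, h2⟩ := collisionMap_eq hpc hq2 hq1.2
    exact ⟨h1, by rw [h2]; exact hq1.1⟩
  refine ⟨(key2 univ univ_mem).mono fun p hp => hp.1, ?_⟩
  intro U hU
  exact (key2 U hU).mono fun p hp => hp.2

theorem isOpen_nextDomain : IsOpen (nextDomain fL fR lam x₀) :=
  isOpen_iff_mem_nhds.2 fun _ hp => (H.continuousAt_collisionMap hp).1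

theorem measurable_collisionMap : Measurable (collisionMap fL fR lam x₀) := by
  classical
  have h : collisionMap fL fR lam x₀ =
      (nextDomain fL fR lam x₀).piecewise (collisionMap fL fR lam x₀) id := by
    ext1 p
    by_cases hp : p ∈ nextDomain fL fR lam x₀
    · rw [piecewise_eq_of_mem _ _ _ hp]
    · rw [piecewise_eq_of_notMem _ _ _ hp, collisionMap, dif_neg hp]; rfl
  rw [h]
  exact ContinuousOn.measurable_piecewise
    (fun p hp => (H.continuousAt_collisionMap hp).2.continuousWithinAt)
    continuous_id.continuousOn H.isOpen_nextDomain.measurableSet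

end LowerTrap

end

/-! ### Almost every state is followed by a non-degenerate collision -/

theorem det_eq_of_prod (L : ℝ × ℝ →L[ℝ] ℝ × ℝ) :
    L.det = (L (1, 0)).1 * (L (0, 1)).2 - (L (0, 1)).1 * (L (1, 0)).2 := by
  rw [ContinuousLinearMap.det, ← LinearMap.det_toMatrix (Module.Basis.finTwoProd ℝ), Matrix.det_fin_two]
  simp [LinearMap.toMatrix_apply]

theorem ae_snd_ne {φ : ℝ → ℝ} (hφ : Measurable φ) : ∀ᵐ p : ℝ × ℝ, p.2 ≠ φ p.1 := by
  rw [ae_iff]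
  simp only [not_not]
  have hm : MeasurableSet {p : ℝ × ℝ | p.2 = φ p.1} :=
    measurableSet_eq_fun measurable_snd (hφ.comp measurable_fst)
  rw [Measure.volume_eq_prod, Measure.measure_prod_null hm]
  filter_upwards with x
  have : Prod.mk x ⁻¹' {p : ℝ × ℝ | p.2 = φ p.1} = {φ x} := by
    ext y; simp
  rw [this]
  simp

theorem ae_fst_notMem {C : Set ℝ} (hC : C.Countable) : ∀ᵐ p : ℝ × ℝ, p.1 ∉ C := by
  have h0 : volume C = 0 := hC.measure_zero _
  rw [ae_iff]
  have : {p : ℝ × ℝ | ¬ p.1 ∉ C} = C ×ˢ univ := by ext p; simp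
  rw [this, Measure.volume_eq_prod, Measure.prod_prod, h0, zero_mul]

/-- By Sard's theorem, almost no line through the graph of `h` is tangent to the graph of `G` at
a later time. -/
theorem ae_not_tangent {h G : ℝ → ℝ} (hh : Differentiable ℝ h) (hG : Differentiable ℝ G) :
    ∀ᵐ p : ℝ × ℝ, ∀ s > p.1, h p.1 + p.2 * (s - p.1) = G s → p.2 ≠ deriv G s := by
  set F : ℝ × ℝ → ℝ × ℝ := fun z => (z.1, (G z.2 - h z.1) / (z.2 - z.1)) with hF
  set S : Set (ℝ × ℝ) := {z | z.1 < z.2 ∧ deriv G z.2 * (z.2 - z.1) = G z.2 - h z.1} with hS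
  have hdiff : ∀ z ∈ S, HasFDerivAt F (fderiv ℝ F z) z := by
    intro z hz
    have h0 : z.2 - z.1 ≠ 0 := by linarith [hz.1]
    refine DifferentiableAt.hasFDerivAt (DifferentiableAt.prodMk differentiableAt_fst ?_)
    have h1 : DifferentiableAt ℝ (fun z : ℝ × ℝ => G z.2 - h z.1) z := by fun_prop
    have h2 : DifferentiableAt ℝ (fun z : ℝ × ℝ => z.2 - z.1) z := by fun_prop
    simp only [div_eq_mul_inv]
    exact h1.mul (h2.fun_inv h0)
  have hdet : ∀ z ∈ S, (fderiv ℝ F z).det = 0 := by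
    intro z hz
    have h0 : z.2 - z.1 ≠ 0 := by linarith [hz.1]
    have h1 : HasDerivAt (fun s => F (z.1, s)) (fderiv ℝ F z (0, 1)) z.2 :=
      (hdiff z hz).comp_hasDerivAt z.2 ((hasDerivAt_const z.2 z.1).prodMk (hasDerivAt_id z.2))
    have h2 : HasDerivAt (fun s => F (z.1, s))
        (0, (deriv G z.2 * (z.2 - z.1) - (G z.2 - h z.1) * 1) / (z.2 - z.1) ^ 2) z.2 :=
      (hasDerivAt_const z.2 z.1).prodMk
        (((hG z.2).hasDerivAt.sub_const (h z.1)).div ((hasDerivAt_id z.2).sub_const z.1) h0)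
    rw [det_eq_of_prod, h1.unique h2, hz.2]
    simp
  have hnull := addHaar_image_eq_zero_of_det_fderivWithin_eq_zero (volume : Measure (ℝ × ℝ))
    (fun z hz => (hdiff z hz).hasFDerivWithinAt) hdet
  rw [ae_iff]
  refine measure_mono_null (fun p hp => ?_) hnull
  simp only [mem_ofPred_eq, not_forall, not_not] at hp
  obtain ⟨s, hs, h1, h2⟩ := hp
  have h0 : s - p.1 ≠ 0 := by have : p.1 < s := hs; linarith
  refine ⟨(p.1, s), ⟨hs, ?_⟩, ?_⟩
  · simp only
    rw [← h2, ← h1]; ring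
  · refine Prod.ext rfl ?_
    simp only [hF]
    rw [← h1]
    field_simp
    ring

section

variable {fL fR : ℝ → ℝ} {lam x₀ : ℝ}

theorem countable_crossing (h0 : 0 < lam) (h1 : lam < 1) : {t | xPos x₀ t = lam}.Countable := by
  refine ((countable_range fun k : ℤ => 2 * (k : ℝ) + (lam - x₀)).union
    (countable_range fun k : ℤ => 2 * (k : ℝ) + (2 - lam - x₀))).mono fun t ht => ?_
  rcases crossing_cases h0 h1 ht with ⟨k, hk, -⟩ | ⟨k, hk, -⟩
  · exact Or.inl ⟨k, hk.symm⟩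
  · exact Or.inr ⟨k, hk.symm⟩

namespace LowerTrap

variable (H : LowerTrap fL fR lam x₀)
include H

theorem ae_isCollisionState : ∀ᵐ p : ℝ × ℝ, IsCollisionState fL fR lam x₀ p := by
  filter_upwards [ae_fst_notMem (countable_crossing (x₀ := x₀) H.lam_pos H.lam_lt_one),
    ae_snd_ne (measurable_deriv fL), ae_snd_ne (measurable_deriv fR)] with p h1 h2 h3
  refine ⟨h1, ?_⟩
  unfold slitVel
  split_ifs <;> assumption

/-- Almost no ball hits a slit at its endpoint on the line `x = lam`. -/
theorem ae_next_ne_lam : ∀ᵐ p : ℝ × ℝ, ∀ q, IsNextCollision fL fR lam x₀ p q →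
    xPos x₀ q.1 ≠ lam := by
  have hc := countable_crossing (x₀ := x₀) H.lam_pos H.lam_lt_one
  have key : ∀ h : ℝ → ℝ, Measurable h → ∀ g : ℝ → ℝ, ∀ᵐ p : ℝ × ℝ, ∀ n : ℤ,
      ∀ c ∈ {t | xPos x₀ t = lam}, p.2 ≠ (cellBase n + (-1) ^ n * g c - h p.1) / (c - p.1) := by
    intro h hh g
    rw [ae_all_iff]
    intro n
    rw [ae_ball_iff hc]
    intro c _
    exact ae_snd_ne (φ := fun t => (cellBase n + (-1) ^ n * g c - h t) / (c - t)) (by fun_prop)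
  have mL := H.contDiff_left.continuous.measurable
  have mR := H.contDiff_right.continuous.measurable
  filter_upwards [key fL mL fL, key fL mL fR, key fR mR fL, key fR mR fR] with p k1 k2 k3 k4 q hq hx
  have hcell := eq_of_cell (Int.floor_le (unfolded fL fR lam x₀ p q.1)) (Int.lt_floor_add_one _).le
  set n := ⌊unfolded fL fR lam x₀ p q.1⌋
  have hne : q.1 - p.1 ≠ 0 := by linarith [hq.1]
  have hv : ∀ y, fold (unfolded fL fR lam x₀ p q.1) = y → p.2 =
      (cellBase n + (-1) ^ n * y - slitFn fL fR lam x₀ p.1 p.1) / (q.1 - p.1) := by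
    intro y hy
    rw [eq_div_iff hne, ← hy, ← hcell, unfolded_eq]
    ring
  rcases slitFn_cases (fL := fL) (fR := fR) (lam := lam) (x₀ := x₀) p.1 with h | h <;>
    rw [h] at hv <;> rcases hq.2.2.1 with ⟨-, h'⟩ | ⟨-, h'⟩
  · exact k1 n q.1 hx (hv _ h')
  · exact k2 n q.1 hx (hv _ h')
  · exact k3 n q.1 hx (hv _ h')
  · exact k4 n q.1 hx (hv _ h')

/-- Almost no ball hits a slit tangentially. -/
theorem ae_next_transversal : ∀ᵐ p : ℝ × ℝ, ∀ q, IsNextCollision fL fR lam x₀ p q →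
    xPos x₀ q.1 ≠ lam → q.2 ≠ slitVel fL fR lam x₀ q.1 := by
  have dL : Differentiable ℝ fL := H.contDiff_left.differentiable (by norm_num)
  have dR : Differentiable ℝ fR := H.contDiff_right.differentiable (by norm_num)
  have key : ∀ h : ℝ → ℝ, Differentiable ℝ h → ∀ g : ℝ → ℝ, Differentiable ℝ g →
      ∀ᵐ p : ℝ × ℝ, ∀ n : ℤ, ∀ s > p.1, h p.1 + p.2 * (s - p.1) = cellBase n + (-1) ^ n * g s →
        p.2 ≠ (-1) ^ n * deriv g s := by
    intro h hh g hg
    rw [ae_all_iff]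
    intro n
    have hd : ∀ s, deriv (fun s => cellBase n + (-1) ^ n * g s) s = (-1) ^ n * deriv g s := by
      intro s
      rw [deriv_const_add, deriv_const_mul_field]
    have := ae_not_tangent hh (G := fun s => cellBase n + (-1) ^ n * g s) (by fun_prop)
    simpa only [hd] using this
  filter_upwards [key fL dL fL dL, key fL dL fR dR, key fR dR fL dL, key fR dR fR dR]
    with p k1 k2 k3 k4 q hq hx hv
  have h1 := next_unfolded hq hx
  rw [unfolded_eq p q.1] at h1
  rw [hq.2.2.2, slitVel_eq, flightVel, unfolded_eq] at hv
  set n := ⌊slitFn fL fR lam x₀ p.1 p.1 + p.2 * (q.1 - p.1)⌋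
  have h2 : p.2 = (-1) ^ n * deriv (slitFn fL fR lam x₀ q.1) q.1 := by
    have : (-1) ^ n * p.2 = deriv (slitFn fL fR lam x₀ q.1) q.1 := by linarith
    rw [← this, ← mul_assoc, neg_one_zpow_sq, one_mul]
  rcases slitFn_cases (fL := fL) (fR := fR) (lam := lam) (x₀ := x₀) p.1 with h | h <;>
    rw [h] at h1 <;>
    rcases slitFn_cases (fL := fL) (fR := fR) (lam := lam) (x₀ := x₀) q.1 with h' | h' <;>
    rw [h'] at h1 h2
  · exact k1 n q.1 hq.1 h1 h2
  · exact k2 n q.1 hq.1 h1 h2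
  · exact k3 n q.1 hq.1 h1 h2
  · exact k4 n q.1 hq.1 h1 h2

theorem ae_mem_nextDomain : ∀ᵐ p : ℝ × ℝ, p ∈ nextDomain fL fR lam x₀ := by
  filter_upwards [H.ae_isCollisionState, H.ae_next_ne_lam, H.ae_next_transversal,
    ae_snd_ne (φ := fun _ => 0) measurable_const] with p h1 h2 h3 h4
  obtain ⟨q, hq⟩ := H.exists_next h1 h4
  exact ⟨h1, q, hq, h2 q hq, h3 q hq (h2 q hq)⟩

end LowerTrap

end

/-! ### The invariant measure -/

/-- An injective map that preserves the measure of the subsets of each piece of a countable cover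
preserves the measure. -/
theorem measure_image_of_countable_cover {X ι : Type*} [MeasurableSpace X] [StandardBorelSpace X]
    [Countable ι] [Nonempty ι] {μ : Measure X} {T : X → X} {A : Set X} (hT : Measurable T)
    (hA : MeasurableSet A) (hinj : InjOn T A) {P : ι → Set X} (hP : ∀ i, MeasurableSet (P i))
    (hcover : A ⊆ ⋃ i, P i)
    (hpiece : ∀ i B, MeasurableSet B → B ⊆ A → B ⊆ P i → μ (T '' B) = μ B) :
    μ (T '' A) = μ A := by
  obtain ⟨e, he⟩ := exists_surjective_nat ι
  set B : ℕ → Set X := fun n => A ∩ disjointed (fun n => P (e n)) n with hB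
  have hBm : ∀ n, MeasurableSet (B n) := fun n =>
    hA.inter (MeasurableSet.disjointed (fun n => hP (e n)) n)
  have hBA : A = ⋃ n, B n := by
    rw [hB, ← inter_iUnion, iUnion_disjointed, eq_comm, inter_eq_left]
    intro x hx
    obtain ⟨i, hi⟩ := mem_iUnion.1 (hcover hx)
    obtain ⟨n, rfl⟩ := he i
    exact mem_iUnion.2 ⟨n, hi⟩
  have hdisj : Pairwise (Function.onFun Disjoint B) := fun m n hmn =>
    (disjoint_disjointed (fun n => P (e n)) hmn).mono inter_subset_right inter_subset_right
  have hBsub : ∀ n, B n ⊆ A := fun n => inter_subset_left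
  have hTdisj : Pairwise (Function.onFun Disjoint fun n => T '' B n) := fun m n hmn =>
    disjoint_left.2 <| by
      rintro _ ⟨x, hx, rfl⟩ ⟨y, hy, he⟩
      rw [hinj (hBsub n hy) (hBsub m hx) he] at hy
      exact disjoint_left.1 (hdisj hmn) hx hy
  have hTm : ∀ n, MeasurableSet (T '' B n) := fun n =>
    (hBm n).image_of_measurable_injOn hT (hinj.mono (hBsub n))
  calc μ (T '' A) = μ (⋃ n, T '' B n) := by rw [← image_iUnion, ← hBA]
    _ = ∑' n, μ (T '' B n) := measure_iUnion hTdisj hTm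
    _ = ∑' n, μ (B n) := by
        congr 1
        ext n
        exact hpiece (e n) _ (hBm n) (hBsub n)
          (inter_subset_right.trans (disjointed_subset _ _))
    _ = μ A := by rw [← measure_iUnion hdisj hBm, ← hBA]

theorem fold_cellBase_add (n : ℤ) (x : ℝ) : fold (cellBase n + (-1) ^ n * x) = fold x := by
  unfold cellBase
  rcases Int.even_or_odd n with h | h
  · rw [h.neg_one_zpow, if_pos h]
    obtain ⟨k, rfl⟩ := h
    rw [← fold_add_two_mul x k]
    congr 1; push_cast; ring
  · rw [h.neg_one_zpow, if_neg (Int.not_even_iff_odd.2 h)]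
    obtain ⟨k, rfl⟩ := h
    rw [← fold_neg x, ← fold_add_two_mul (-x) (k + 1)]
    congr 1; push_cast; ring

/-- The coordinates of the line in the `(time, unfolded height)` plane along which a ball leaves
the graph of `f` in the state `p`: its height at time `0` and its slope. -/
noncomputable def outLine (f : ℝ → ℝ) (p : ℝ × ℝ) : ℝ × ℝ := (f p.1 - p.2 * p.1, p.2)

/-- The coordinates of the line in the `(time, unfolded height)` plane along which a ball arrives
at the graph of `f`, in the cell `[n, n + 1]` of the unfolded line, before it is reflected into the
state `q`. -/
noncomputable def inLine (n : ℤ) (f : ℝ → ℝ) (q : ℝ × ℝ) : ℝ × ℝ :=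
  (cellBase n + (-1) ^ n * f q.1 - (-1) ^ n * (2 * deriv f q.1 - q.2) * q.1,
    (-1) ^ n * (2 * deriv f q.1 - q.2))

theorem hasDerivAt_fst_of_prod {Φ : ℝ × ℝ → ℝ × ℝ} {L : ℝ × ℝ →L[ℝ] ℝ × ℝ} {p : ℝ × ℝ}
    (h : HasFDerivAt Φ L p) : HasDerivAt (fun t => Φ (t, p.2)) (L (1, 0)) p.1 :=
  HasFDerivAt.comp_hasDerivAt (f := fun t => (t, p.2)) p.1 h
    ((hasDerivAt_id p.1).prodMk (hasDerivAt_const p.1 p.2))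

theorem hasDerivAt_snd_of_prod {Φ : ℝ × ℝ → ℝ × ℝ} {L : ℝ × ℝ →L[ℝ] ℝ × ℝ} {p : ℝ × ℝ}
    (h : HasFDerivAt Φ L p) : HasDerivAt (fun v => Φ (p.1, v)) (L (0, 1)) p.2 :=
  HasFDerivAt.comp_hasDerivAt (f := fun v => (p.1, v)) p.2 h
    ((hasDerivAt_const p.2 p.1).prodMk (hasDerivAt_id p.2))

theorem hasFDerivAt_outLine {f : ℝ → ℝ} (hf : Differentiable ℝ f) (p : ℝ × ℝ) :
    ∃ L : ℝ × ℝ →L[ℝ] ℝ × ℝ, HasFDerivAt (outLine f) L p ∧ |L.det| = |p.2 - deriv f p.1| := by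
  have hd : HasFDerivAt (outLine f) (fderiv ℝ (outLine f) p) p := by
    apply DifferentiableAt.hasFDerivAt
    unfold outLine
    fun_prop
  refine ⟨_, hd, ?_⟩
  have e1 := hasDerivAt_fst_of_prod hd
  have e2 := hasDerivAt_snd_of_prod hd
  have e1' : HasDerivAt (fun t => outLine f (t, p.2)) (deriv f p.1 - p.2 * 1, 0) p.1 :=
    ((hf p.1).hasDerivAt.sub ((hasDerivAt_id p.1).const_mul p.2)).prodMk (hasDerivAt_const _ _)
  have e2' : HasDerivAt (fun v => outLine f (p.1, v)) (-(1 * p.1), 1) p.2 :=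
    (((hasDerivAt_id p.2).mul_const p.1).const_sub (f p.1)).prodMk (hasDerivAt_id _)
  rw [det_eq_of_prod, e1.unique e1', e2.unique e2', abs_sub_comm]
  congr 1
  ring

theorem hasFDerivAt_inLine {f : ℝ → ℝ} (hf : ContDiff ℝ 2 f) (n : ℤ) (q : ℝ × ℝ) :
    ∃ L : ℝ × ℝ →L[ℝ] ℝ × ℝ, HasFDerivAt (inLine n f) L q ∧ |L.det| = |q.2 - deriv f q.1| := by
  have hf1 : Differentiable ℝ f := hf.differentiable (by norm_num)
  have hf2 : Differentiable ℝ (deriv f) := by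
    have h : ContDiff ℝ (1 + 1) f := by norm_num; exact hf
    exact (contDiff_succ_iff_deriv.1 h).2.2.differentiable (by norm_num)
  have hd : HasFDerivAt (inLine n f) (fderiv ℝ (inLine n f) q) q := by
    apply DifferentiableAt.hasFDerivAt
    unfold inLine
    fun_prop
  refine ⟨_, hd, ?_⟩
  have e1 := hasDerivAt_fst_of_prod hd
  have e2 := hasDerivAt_snd_of_prod hd
  have w1 : HasDerivAt (fun t => (-1 : ℝ) ^ n * (2 * deriv f t - q.2))
      ((-1 : ℝ) ^ n * (2 * deriv (deriv f) q.1)) q.1 :=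
    (((hf2 q.1).hasDerivAt.const_mul 2).sub_const q.2).const_mul _
  have w2 : HasDerivAt (fun v => (-1 : ℝ) ^ n * (2 * deriv f q.1 - v)) ((-1 : ℝ) ^ n * -1) q.2 :=
    ((hasDerivAt_id q.2).const_sub (2 * deriv f q.1)).const_mul _
  have e1' : HasDerivAt (fun t => inLine n f (t, q.2))
      ((-1 : ℝ) ^ n * deriv f q.1 - ((-1 : ℝ) ^ n * (2 * deriv (deriv f) q.1) * q.1 +
        (-1 : ℝ) ^ n * (2 * deriv f q.1 - q.2) * 1),
        (-1 : ℝ) ^ n * (2 * deriv (deriv f) q.1)) q.1 :=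
    ((((hf1 q.1).hasDerivAt.const_mul _).const_add _).sub (w1.mul (hasDerivAt_id q.1))).prodMk w1
  have e2' : HasDerivAt (fun v => inLine n f (q.1, v))
      (-((-1 : ℝ) ^ n * -1 * q.1), (-1 : ℝ) ^ n * -1) q.2 :=
    ((w2.mul_const q.1).const_sub (cellBase n + (-1 : ℝ) ^ n * f q.1)).prodMk w2
  rw [det_eq_of_prod, e1.unique e1', e2.unique e2', abs_sub_comm]
  congr 1
  have hsq := neg_one_zpow_sq n
  simp only
  linear_combination (q.2 - deriv f q.1) * hsq

section

variable {fL fR : ℝ → ℝ} {lam x₀ : ℝ}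

/-- The density of the measure that the flow of the ball induces on the collision states: the
speed relative to the slit. -/
noncomputable def fluxDensity (fL fR : ℝ → ℝ) (lam x₀ : ℝ) (p : ℝ × ℝ) : ENNReal :=
  ENNReal.ofReal |p.2 - slitVel fL fR lam x₀ p.1|

/-- The measure that the flow of the ball induces on the collision states. -/
noncomputable def fluxMeasure (fL fR : ℝ → ℝ) (lam x₀ : ℝ) : Measure (ℝ × ℝ) :=
  (volume : Measure (ℝ × ℝ)).withDensity (fluxDensity fL fR lam x₀)

theorem measurableSet_left : MeasurableSet {t | xPos x₀ t < lam} :=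
  (isOpen_lt continuous_xPos continuous_const).measurableSet

theorem measurable_slitVel : Measurable (slitVel fL fR lam x₀) :=
  Measurable.ite measurableSet_left (measurable_deriv fL) (measurable_deriv fR)

theorem measurable_fluxDensity : Measurable (fluxDensity fL fR lam x₀) := by
  have := measurable_slitVel (fL := fL) (fR := fR) (lam := lam) (x₀ := x₀)
  unfold fluxDensity
  exact ENNReal.measurable_ofReal.comp (measurable_snd.sub (this.comp measurable_fst)).norm

/-- The flight that leads to the state `q` is determined by `q`. -/
theorem flightHeight_eq_of_next {p q : ℝ × ℝ} (h : IsNextCollision fL fR lam x₀ p q)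
    (hx : xPos x₀ q.1 ≠ lam) (s : ℝ) : flightHeight fL fR lam x₀ p s =
      fold (slitFn fL fR lam x₀ q.1 q.1 + (2 * slitVel fL fR lam x₀ q.1 - q.2) * (s - q.1)) := by
  have h1 := next_unfolded h hx
  have h2 := h.2.2.2
  unfold flightVel at h2
  set n := ⌊unfolded fL fR lam x₀ p q.1⌋
  rw [← fold_cellBase_add n, flightHeight]
  congr 1
  have h3 : unfolded fL fR lam x₀ p s = unfolded fL fR lam x₀ p q.1 + p.2 * (s - q.1) := by
    rw [unfolded_eq, unfolded_eq]; ring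
  rw [h3, h1, h2]
  linear_combination -p.2 * (s - q.1) * neg_one_zpow_sq n

theorem volume_image_eq_flux {f : ℝ → ℝ} {A : Set (ℝ × ℝ)} (hA : MeasurableSet A)
    (hf : ∀ p ∈ A, slitFn fL fR lam x₀ p.1 = f) {Φ : ℝ × ℝ → ℝ × ℝ} (hinj : InjOn Φ A)
    (hΦ : ∀ p, ∃ L : ℝ × ℝ →L[ℝ] ℝ × ℝ, HasFDerivAt Φ L p ∧ |L.det| = |p.2 - deriv f p.1|) :
    volume (Φ '' A) = fluxMeasure fL fR lam x₀ A := by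
  choose L hL hdet using hΦ
  rw [← lintegral_abs_det_fderiv_eq_addHaar_image volume hA
    (fun p _ => (hL p).hasFDerivWithinAt) hinj, fluxMeasure, withDensity_apply _ hA]
  refine setLIntegral_congr_fun hA fun p hp => ?_
  rw [hdet, fluxDensity, slitVel_eq, hf p hp]

namespace LowerTrap

variable (H : LowerTrap fL fR lam x₀)
include H

theorem flux_eq_zero_iff {s : Set (ℝ × ℝ)} : fluxMeasure fL fR lam x₀ s = 0 ↔ volume s = 0 := by
  constructor
  · intro h
    refine withDensity_absolutelyContinuous' measurable_fluxDensity.aemeasurable ?_ h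
    filter_upwards [H.ae_isCollisionState] with p hp
    simp only [fluxDensity, ne_eq, ENNReal.ofReal_eq_zero, not_le, abs_pos]
    exact sub_ne_zero.2 hp.2
  · intro h
    exact withDensity_absolutelyContinuous _ _ h

theorem flightHeight_self (p : ℝ × ℝ) :
    flightHeight fL fR lam x₀ p p.1 = slitFn fL fR lam x₀ p.1 p.1 := by
  have h := H.slitFn_mem p.1 p.1
  rw [flightHeight, unfolded_eq, sub_self, mul_zero, add_zero,
    fold_of_abs_le (abs_le.2 ⟨by linarith [h.1], h.2.le⟩), abs_of_pos h.1]

theorem injOn_collisionMap : InjOn (collisionMap fL fR lam x₀) (nextDomain fL fR lam x₀) := by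
  have key : ∀ p p' q : ℝ × ℝ, IsCollisionState fL fR lam x₀ p' →
      IsNextCollision fL fR lam x₀ p q → IsNextCollision fL fR lam x₀ p' q →
      xPos x₀ q.1 ≠ lam → ¬ p.1 < p'.1 := by
    intro p p' q hp' hpq hpq' hx hlt
    apply hpq.2.1 p'.1 ⟨hlt, hpq'.1⟩
    rw [touches_iff hp'.1, flightHeight_eq_of_next hpq hx, ← flightHeight_eq_of_next hpq' hx,
      H.flightHeight_self]
  intro p hp p' hp' he
  obtain ⟨h1, h2⟩ := collisionMap_spec hp
  obtain ⟨h1', h2'⟩ := collisionMap_spec hp'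
  rw [← he] at h1' h2'
  set q := collisionMap fL fR lam x₀ p
  have ht : p.1 = p'.1 := le_antisymm (not_lt.1 (key p' p q hp.1 h1' h1 h2.1))
    (not_lt.1 (key p p' q hp'.1 h1 h1' h2.1))
  refine Prod.ext ht ?_
  have hfl : ∀ s, flightHeight fL fR lam x₀ p s = flightHeight fL fR lam x₀ p' s := fun s => by
    rw [flightHeight_eq_of_next h1 h2.1, flightHeight_eq_of_next h1' h2.1]
  have hv := h1.2.2.2
  have hv' := h1'.2.2.2
  unfold flightVel at hv hv'
  have habs : |p.2| = |p'.2| := by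
    have : (-1 : ℝ) ^ ⌊unfolded fL fR lam x₀ p q.1⌋ * p.2 =
        (-1 : ℝ) ^ ⌊unfolded fL fR lam x₀ p' q.1⌋ * p'.2 := by linarith
    have := congrArg abs this
    rwa [abs_mul, abs_mul, abs_neg_one_zpow', abs_neg_one_zpow', one_mul, one_mul] at this
  rcases abs_eq_abs.1 habs with h | h
  · exact h
  by_cases h0 : p.2 = 0
  · rw [h0] at h ⊢; linarith
  -- with opposite velocities, the two flights separate after a short time
  exfalso
  have hm := H.slitFn_mem p.1 p.1
  have hs := hfl (p.1 + min (slitFn fL fR lam x₀ p.1 p.1) (1 - slitFn fL fR lam x₀ p.1 p.1) / p.2)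
  rw [flightHeight, flightHeight, unfolded_eq, unfolded_eq, ← ht, show p'.2 = -p.2 by linarith]
    at hs
  set g := slitFn fL fR lam x₀ p.1 p.1
  have hmin1 : min g (1 - g) ≤ g := min_le_left _ _
  have hmin2 : min g (1 - g) ≤ 1 - g := min_le_right _ _
  have hmin0 : 0 < min g (1 - g) := lt_min hm.1 (by linarith [hm.2])
  set d := min g (1 - g)
  have e1 : g + p.2 * (p.1 + d / p.2 - p.1) = g + d := by field_simp; ring
  have e2 : g + -p.2 * (p.1 + d / p.2 - p.1) = g - d := by field_simp; ring
  rw [e1, e2, fold_of_abs_le (abs_le.2 ⟨by linarith, by linarith⟩),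
    fold_of_abs_le (abs_le.2 ⟨by linarith, by linarith [hm.2]⟩),
    abs_of_nonneg (by linarith), abs_of_nonneg (by linarith)] at hs
  linarith

theorem flux_image_of_piece {A : Set (ℝ × ℝ)} (hA : MeasurableSet A)
    (hAD : A ⊆ nextDomain fL fR lam x₀) {r : ℝ} {n : ℤ} {f g : ℝ → ℝ} (hf : ContDiff ℝ 2 f)
    (hg : ContDiff ℝ 2 g)
    (hr : ∀ p ∈ A, p.1 < r ∧ r < (collisionMap fL fR lam x₀ p).1)
    (hn : ∀ p ∈ A, ⌊unfolded fL fR lam x₀ p (collisionMap fL fR lam x₀ p).1⌋ = n)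
    (hsf : ∀ p ∈ A, slitFn fL fR lam x₀ p.1 = f)
    (hsg : ∀ p ∈ A, slitFn fL fR lam x₀ (collisionMap fL fR lam x₀ p).1 = g) :
    fluxMeasure fL fR lam x₀ (collisionMap fL fR lam x₀ '' A) = fluxMeasure fL fR lam x₀ A := by
  have hTA : MeasurableSet (collisionMap fL fR lam x₀ '' A) :=
    hA.image_of_measurable_injOn H.measurable_collisionMap (H.injOn_collisionMap.mono hAD)
  have hout : InjOn (outLine f) A := by
    have key : ∀ p ∈ A, ∀ p' ∈ A, outLine f p = outLine f p' → ¬ p.1 < p'.1 := by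
      intro p hp p' hp' he hlt
      obtain ⟨h1, h2⟩ := Prod.ext_iff.1 he
      simp only [outLine] at h1 h2
      have hpq := (collisionMap_spec (hAD hp)).1
      refine hpq.2.1 p'.1 ⟨hlt, (hr p' hp').1.trans (hr p hp).2⟩ ?_
      rw [touches_iff (hAD hp').1.1, ← H.flightHeight_self p', flightHeight, flightHeight]
      congr 1
      rw [unfolded_eq, unfolded_eq, hsf p hp, hsf p' hp', h2]
      rw [h2] at h1
      linear_combination h1
    intro p hp p' hp' he
    exact Prod.ext (le_antisymm (not_lt.1 (key p' hp' p hp he.symm)) (not_lt.1 (key p hp p' hp' he)))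
      (Prod.ext_iff.1 he).2
  have hcomp : ∀ p ∈ A, inLine n g (collisionMap fL fR lam x₀ p) = outLine f p := by
    intro p hp
    obtain ⟨hpq, hq⟩ := collisionMap_spec (hAD hp)
    have h1 := next_unfolded hpq hq.1
    have h2 := hpq.2.2.2
    unfold flightVel at h2
    rw [slitVel_eq, hn p hp, hsg p hp] at h2
    rw [hn p hp, hsg p hp, unfolded_eq, hsf p hp] at h1
    have hw : (-1 : ℝ) ^ n * (2 * deriv g (collisionMap fL fR lam x₀ p).1 -
        (collisionMap fL fR lam x₀ p).2) = p.2 := by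
      rw [h2]; linear_combination p.2 * neg_one_zpow_sq n
    unfold inLine outLine
    rw [hw, ← h1]
    refine Prod.ext ?_ rfl
    simp only
    ring
  have hin : InjOn (inLine n g) (collisionMap fL fR lam x₀ '' A) := by
    rintro _ ⟨p, hp, rfl⟩ _ ⟨p', hp', rfl⟩ he
    rw [hcomp p hp, hcomp p' hp'] at he
    rw [hout hp hp' he]
  rw [← volume_image_eq_flux hA hsf hout (hasFDerivAt_outLine (hf.differentiable (by norm_num))),
    ← volume_image_eq_flux hTA (by rintro _ ⟨p, hp, rfl⟩; exact hsg p hp) hin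
      (hasFDerivAt_inLine hg n), image_image]
  congr 1
  exact image_congr hcomp

/-- The collision map preserves the flux measure. A collision state is determined by the line in
the `(time, unfolded height)` plane along which the ball leaves, and also by the one along which it
arrives; in both cases the flux measure is the Lebesgue measure on the lines. -/
theorem flux_image {A : Set (ℝ × ℝ)} (hA : MeasurableSet A)
    (hAD : A ⊆ nextDomain fL fR lam x₀) :
    fluxMeasure fL fR lam x₀ (collisionMap fL fR lam x₀ '' A) = fluxMeasure fL fR lam x₀ A := by
  set T := collisionMap fL fR lam x₀ with hT
  have mT : Measurable T := H.measurable_collisionMap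
  have mU : Measurable fun p : ℝ × ℝ => unfolded fL fR lam x₀ p (T p).1 := by
    have mh : Measurable (slitHeight fL fR lam x₀) :=
      Measurable.ite measurableSet_left H.contDiff_left.continuous.measurable
        H.contDiff_right.continuous.measurable
    unfold unfolded
    fun_prop
  have mside : ∀ b : Bool, MeasurableSet {t | xPos x₀ t < lam ↔ b = true} := by
    intro b
    cases b
    · have : {t | xPos x₀ t < lam ↔ false = true} = {t | xPos x₀ t < lam}ᶜ := by ext t; simp
      rw [this]
      exact measurableSet_left.compl
    · have : {t | xPos x₀ t < lam ↔ true = true} = {t | xPos x₀ t < lam} := by ext t; simp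
      rw [this]
      exact measurableSet_left
  have hside : ∀ (b : Bool) (t : ℝ), (xPos x₀ t < lam ↔ b = true) →
      slitFn fL fR lam x₀ t = if b then fL else fR := by
    intro b t h
    unfold slitFn
    simp only [h]
  have hsm : ∀ b : Bool, ContDiff ℝ 2 (if b then fL else fR) := by
    intro b
    cases b
    exacts [H.contDiff_right, H.contDiff_left]
  refine measure_image_of_countable_cover (ι := ℚ × ℤ × Bool × Bool)
    (P := fun i => {p | p.1 < i.1 ∧ (i.1 : ℝ) < (T p).1 ∧
      ⌊unfolded fL fR lam x₀ p (T p).1⌋ = i.2.1 ∧ (xPos x₀ p.1 < lam ↔ i.2.2.1 = true) ∧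
      (xPos x₀ (T p).1 < lam ↔ i.2.2.2 = true)})
    mT hA (H.injOn_collisionMap.mono hAD) ?_ ?_ ?_
  · intro i
    refine (measurableSet_lt measurable_fst measurable_const).inter
      ((measurableSet_lt measurable_const mT.fst).inter
      ((measurableSet_eq_fun mU.floor measurable_const).inter
      (((mside i.2.2.1).preimage measurable_fst).inter ((mside i.2.2.2).preimage mT.fst))))
  · intro p hp
    obtain ⟨r, hr1, hr2⟩ := exists_rat_btwn (collisionMap_spec (hAD hp)).1.1
    refine mem_iUnion.2 ⟨(r, ⌊unfolded fL fR lam x₀ p (T p).1⌋, decide (xPos x₀ p.1 < lam),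
      decide (xPos x₀ (T p).1 < lam)), hr1, hr2, rfl, ?_, ?_⟩ <;> simp
  · intro i B hB hBA hBP
    exact H.flux_image_of_piece hB (hBA.trans hAD) (hsm i.2.2.1) (hsm i.2.2.2)
      (r := i.1) (n := i.2.1) (fun p hp => ⟨(hBP hp).1, (hBP hp).2.1⟩)
      (fun p hp => (hBP hp).2.2.1) (fun p hp => hside _ _ (hBP hp).2.2.2.1)
      (fun p hp => hside _ _ (hBP hp).2.2.2.2)

/-- The states that the collision map sends into a null set form a null set. -/
theorem ae_collisionMap {Q : ℝ × ℝ → Prop} (hQ : ∀ᵐ p, Q p) :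
    ∀ᵐ p, Q (collisionMap fL fR lam x₀ p) := by
  have h0 : volume (toMeasurable volume {p | ¬ Q p}) = 0 := by
    rw [measure_toMeasurable]; exact hQ
  set N := toMeasurable volume {p | ¬ Q p}
  have hN : MeasurableSet N := measurableSet_toMeasurable _ _
  have hA : MeasurableSet (nextDomain fL fR lam x₀ ∩ collisionMap fL fR lam x₀ ⁻¹' N) :=
    H.isOpen_nextDomain.measurableSet.inter (H.measurable_collisionMap hN)
  have h1 : volume (nextDomain fL fR lam x₀ ∩ collisionMap fL fR lam x₀ ⁻¹' N) = 0 := by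
    rw [← H.flux_eq_zero_iff, ← H.flux_image hA inter_subset_left, H.flux_eq_zero_iff]
    refine measure_mono_null ?_ h0
    rintro _ ⟨p, hp, rfl⟩
    exact hp.2
  filter_upwards [H.ae_mem_nextDomain, measure_eq_zero_iff_ae_notMem.1 h1] with p hp1 hp2
  by_contra hQp
  exact hp2 ⟨hp1, subset_toMeasurable _ _ hQp⟩

end LowerTrap

end

/-! ### Uniform bounds -/

/-- Bounds for the height of a slit, for its velocity, and for the Lipschitz constant of its
velocity. -/
structure SlitBounds (m M : ℝ) (f : ℝ → ℝ) : Prop where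
  lower : ∀ t, m ≤ f t
  upper : ∀ t, f t ≤ 1 - m
  deriv_le : ∀ t, |deriv f t| ≤ M
  deriv_lip : ∀ s t, |deriv f s - deriv f t| ≤ M * |s - t|
  differentiable : Differentiable ℝ f

theorem SlitBounds.mono {m M m' M' : ℝ} {f : ℝ → ℝ} (h : SlitBounds m M f) (hm : m' ≤ m)
    (hM : M ≤ M') : SlitBounds m' M' f where
  lower t := hm.trans (h.lower t)
  upper t := (h.upper t).trans (by linarith)
  deriv_le t := (h.deriv_le t).trans hM
  deriv_lip s t := (h.deriv_lip s t).trans (mul_le_mul_of_nonneg_right hM (abs_nonneg _))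
  differentiable := h.differentiable

theorem periodic_deriv {f : ℝ → ℝ} {c : ℝ} (hf : Function.Periodic f c) :
    Function.Periodic (deriv f) c := by
  intro t
  rw [← deriv_comp_add_const]
  congr 1
  exact funext hf

theorem exists_abs_le_of_periodic {f : ℝ → ℝ} (hf : Function.Periodic f 2) (hc : Continuous f) :
    ∃ M, ∀ t, |f t| ≤ M := by
  obtain ⟨M, hM⟩ := (hf.compact_of_continuous two_ne_zero hc).isBounded.exists_norm_le
  exact ⟨M, fun t => hM _ (mem_range_self t)⟩

theorem exists_slitBounds {f : ℝ → ℝ} (hf : ContDiff ℝ 2 f) (hper : Function.Periodic f 2)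
    (hmem : ∀ t, f t ∈ Ioo (0 : ℝ) 1) : ∃ m > 0, ∃ M, SlitBounds m M f := by
  have hc := hf.continuous
  have hcomp := hper.compact_of_continuous two_ne_zero hc
  obtain ⟨_, ⟨a, rfl⟩, ha⟩ := hcomp.exists_isLeast (range_nonempty f)
  obtain ⟨_, ⟨b, rfl⟩, hb⟩ := hcomp.exists_isGreatest (range_nonempty f)
  have hd : ContDiff ℝ 1 (deriv f) := by
    have h : ContDiff ℝ (1 + 1) f := by norm_num; exact hf
    exact (contDiff_succ_iff_deriv.1 h).2.2
  obtain ⟨M₁, hM₁⟩ := exists_abs_le_of_periodic (periodic_deriv hper) hd.continuous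
  obtain ⟨M₂, hM₂⟩ := exists_abs_le_of_periodic (periodic_deriv (periodic_deriv hper))
    (hd.continuous_deriv (by norm_num))
  refine ⟨min (f a) (1 - f b), lt_min (hmem a).1 (by linarith [(hmem b).2]), max M₁ M₂,
    fun t => (min_le_left _ _).trans (ha (mem_range_self t)), fun t => ?_,
    fun t => (hM₁ t).trans (le_max_left _ _), fun s t => ?_, hf.differentiable (by norm_num)⟩
  · have h1 := hb (mem_range_self t)
    have h2 := min_le_right (f a) (1 - f b)
    linarith
  · exact convex_univ.norm_image_sub_le_of_norm_deriv_le (𝕜 := ℝ)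
      (fun x _ => hd.differentiable (by norm_num) x)
      (fun x _ => (hM₂ x).trans (le_max_right _ _)) (mem_univ t) (mem_univ s)

section

variable {fL fR : ℝ → ℝ} {lam x₀ : ℝ}

theorem LowerTrap.exists_bounds (H : LowerTrap fL fR lam x₀) : ∃ m > 0, ∃ M ≥ 1,
    SlitBounds m M fL ∧ SlitBounds m M fR := by
  obtain ⟨m₁, h₁, M₁, b₁⟩ := exists_slitBounds H.contDiff_left H.periodic_left H.left_mem
  obtain ⟨m₂, h₂, M₂, b₂⟩ := exists_slitBounds H.contDiff_right H.periodic_right H.right_mem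
  exact ⟨min m₁ m₂, lt_min h₁ h₂, max 1 (max M₁ M₂), le_max_left _ _,
    b₁.mono (min_le_left _ _) ((le_max_left _ _).trans (le_max_right _ _)),
    b₂.mono (min_le_right _ _) ((le_max_right _ _).trans (le_max_right _ _))⟩

theorem slitBounds_slitFn {m M : ℝ} (hL : SlitBounds m M fL) (hR : SlitBounds m M fR) (t : ℝ) :
    SlitBounds m M (slitFn fL fR lam x₀ t) := by
  rcases slitFn_cases (fL := fL) (fR := fR) (lam := lam) (x₀ := x₀) t with h | h <;> rw [h] <;>
    assumption

/-! ### Periodicity -/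

/-- Shift of the time of a state by `k` periods. -/
def timeShift (k : ℤ) (p : ℝ × ℝ) : ℝ × ℝ := (p.1 + 2 * k, p.2)

/-- The states with a time in the period that begins at `2 * k`. -/
def periodStrip (k : ℤ) : Set (ℝ × ℝ) := {p | 2 * (k : ℝ) ≤ p.1 ∧ p.1 < 2 * k + 2}

theorem timeShift_neg (k : ℤ) (p : ℝ × ℝ) : timeShift k (timeShift (-k) p) = p := by
  refine Prod.ext ?_ rfl
  simp [timeShift]

theorem timeShift_neg' (k : ℤ) (p : ℝ × ℝ) : timeShift (-k) (timeShift k p) = p := by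
  have := timeShift_neg (-k) p
  rwa [neg_neg] at this

theorem measurable_timeShift (k : ℤ) : Measurable (timeShift k) := by
  unfold timeShift; fun_prop

theorem measurableSet_periodStrip (k : ℤ) : MeasurableSet (periodStrip k) :=
  (measurableSet_le measurable_const measurable_fst).inter
    (measurableSet_lt measurable_fst measurable_const)

theorem iUnion_periodStrip : ⋃ k, periodStrip k = univ := by
  refine eq_univ_of_forall fun p => mem_iUnion.2 ⟨⌊p.1 / 2⌋, ?_, ?_⟩
  · have := Int.floor_le (p.1 / 2); linarith
  · have := Int.lt_floor_add_one (p.1 / 2); linarith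

theorem eq_of_mem_periodStrip {p : ℝ × ℝ} {i j : ℤ} (hi : p ∈ periodStrip i)
    (hj : p ∈ periodStrip j) : i = j := by
  obtain ⟨h1, h2⟩ := hi
  obtain ⟨h3, h4⟩ := hj
  have h5 : (i : ℝ) < j + 1 := by linarith
  have h6 : (j : ℝ) < i + 1 := by linarith
  have h7 : i < j + 1 := by exact_mod_cast h5
  have h8 : j < i + 1 := by exact_mod_cast h6
  omega

theorem timeShift_mem_periodStrip {p : ℝ × ℝ} {k : ℤ} :
    timeShift k p ∈ periodStrip k ↔ p ∈ periodStrip 0 := by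
  simp only [timeShift, periodStrip, mem_ofPred_eq, Int.cast_zero, mul_zero, zero_add]
  constructor <;> rintro ⟨h1, h2⟩ <;> constructor <;> linarith

theorem xPos_add (t : ℝ) (k : ℤ) : xPos x₀ (t + 2 * k) = xPos x₀ t := by
  unfold xPos
  rw [← add_assoc, fold_add_two_mul]

namespace LowerTrap

variable (H : LowerTrap fL fR lam x₀)
include H

theorem slitHeight_add (t : ℝ) (k : ℤ) :
    slitHeight fL fR lam x₀ (t + 2 * k) = slitHeight fL fR lam x₀ t := by
  unfold slitHeight
  rw [xPos_add, add_comm, periodic_two_mul H.periodic_left, periodic_two_mul H.periodic_right]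

theorem slitVel_add (t : ℝ) (k : ℤ) :
    slitVel fL fR lam x₀ (t + 2 * k) = slitVel fL fR lam x₀ t := by
  unfold slitVel
  rw [xPos_add, add_comm, periodic_two_mul (periodic_deriv H.periodic_left),
    periodic_two_mul (periodic_deriv H.periodic_right)]

theorem touches_add (s y : ℝ) (k : ℤ) :
    Touches fL fR lam x₀ (s + 2 * k) y ↔ Touches fL fR lam x₀ s y := by
  unfold Touches
  rw [xPos_add, add_comm, periodic_two_mul H.periodic_left, periodic_two_mul H.periodic_right]

theorem unfolded_timeShift (p : ℝ × ℝ) (s : ℝ) (k : ℤ) :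
    unfolded fL fR lam x₀ (timeShift k p) (s + 2 * k) = unfolded fL fR lam x₀ p s := by
  simp only [unfolded, timeShift]
  rw [H.slitHeight_add]
  ring

theorem isCollisionState_timeShift {p : ℝ × ℝ} (hp : IsCollisionState fL fR lam x₀ p) (k : ℤ) :
    IsCollisionState fL fR lam x₀ (timeShift k p) :=
  ⟨by simpa only [timeShift, xPos_add] using hp.1,
    by simpa only [timeShift, H.slitVel_add] using hp.2⟩

theorem isNextCollision_timeShift {p q : ℝ × ℝ} (h : IsNextCollision fL fR lam x₀ p q) (k : ℤ) :
    IsNextCollision fL fR lam x₀ (timeShift k p) (timeShift k q) := by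
  have hU := H.unfolded_timeShift p
  refine ⟨by simp only [timeShift]; linarith [h.1], ?_, ?_, ?_⟩
  · intro s hs
    simp only [timeShift] at hs
    have hs' : s = (s - 2 * k) + 2 * k := by ring
    rw [hs', H.touches_add, flightHeight, hU]
    exact h.2.1 _ ⟨by linarith [hs.1], by linarith [hs.2]⟩
  · rw [show (timeShift k q).1 = q.1 + 2 * k from rfl, H.touches_add, flightHeight, hU]
    exact h.2.2.1
  · rw [show (timeShift k q).1 = q.1 + 2 * k from rfl, H.slitVel_add, flightVel, hU]
    exact h.2.2.2

theorem collisionMap_timeShift {p : ℝ × ℝ} (hp : p ∈ nextDomain fL fR lam x₀) (k : ℤ) :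
    timeShift k p ∈ nextDomain fL fR lam x₀ ∧
    collisionMap fL fR lam x₀ (timeShift k p) = timeShift k (collisionMap fL fR lam x₀ p) := by
  obtain ⟨h1, h2⟩ := collisionMap_spec hp
  exact collisionMap_eq (H.isCollisionState_timeShift hp.1 k) (H.isNextCollision_timeShift h1 k)
    (H.isCollisionState_timeShift h2 k)

theorem flux_preimage_timeShift (k : ℤ) {S : Set (ℝ × ℝ)} (hS : MeasurableSet S) :
    fluxMeasure fL fR lam x₀ (timeShift k ⁻¹' S) = fluxMeasure fL fR lam x₀ S := by
  have hmp : MeasurePreserving (timeShift k) (volume : Measure (ℝ × ℝ)) volume := by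
    have : timeShift k = fun p : ℝ × ℝ => p + (2 * (k : ℝ), 0) := by
      ext p <;> simp [timeShift]
    rw [this]
    exact measurePreserving_add_right _ _
  rw [fluxMeasure, withDensity_apply _ hS, withDensity_apply _ (measurable_timeShift k hS),
    ← hmp.setLIntegral_comp_preimage hS measurable_fluxDensity]
  refine setLIntegral_congr_fun (measurable_timeShift k hS) fun p _ => ?_
  simp only [fluxDensity, timeShift, H.slitVel_add]

/-! ### Recurrence -/

/-- If the collision map sends a set that is invariant under the shifts of the time by periods into
`B`, then the flux measure per period of the set is at most that of `B`: modulo the period, the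
collision map is still injective and preserves the flux measure. -/
theorem flux_periodStrip_le {A B : Set (ℝ × ℝ)} (hA : MeasurableSet A)
    (hAD : A ⊆ nextDomain fL fR lam x₀)
    (hAinv : ∀ p ∈ A, ∀ k, timeShift k p ∈ A)
    (hAB : ∀ p ∈ A, collisionMap fL fR lam x₀ p ∈ B) :
    fluxMeasure fL fR lam x₀ (A ∩ periodStrip 0) ≤ fluxMeasure fL fR lam x₀ (B ∩ periodStrip 0) := by
  set T := collisionMap fL fR lam x₀ with hT
  set A₀ := A ∩ periodStrip 0 with hA₀
  have hA₀m : MeasurableSet A₀ := hA.inter (measurableSet_periodStrip 0)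
  have hA₀D : A₀ ⊆ nextDomain fL fR lam x₀ := inter_subset_left.trans hAD
  have hTA₀ : MeasurableSet (T '' A₀) :=
    hA₀m.image_of_measurable_injOn H.measurable_collisionMap (H.injOn_collisionMap.mono hA₀D)
  have hEm : ∀ j : ℤ, MeasurableSet (T '' A₀ ∩ periodStrip j) := fun j =>
    hTA₀.inter (measurableSet_periodStrip j)
  have hCm : ∀ j : ℤ, MeasurableSet (timeShift j ⁻¹' (T '' A₀ ∩ periodStrip j)) := fun j =>
    measurable_timeShift j (hEm j)
  have hEdisj : Pairwise (Function.onFun Disjoint fun j : ℤ => T '' A₀ ∩ periodStrip j) :=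
    fun i j hij => disjoint_left.2 fun p hp hp' => hij (eq_of_mem_periodStrip hp.2 hp'.2)
  have hCdisj : Pairwise (Function.onFun Disjoint
      fun j : ℤ => timeShift j ⁻¹' (T '' A₀ ∩ periodStrip j)) := by
    intro i j hij
    refine disjoint_left.2 ?_
    rintro p ⟨⟨a, ha, hap⟩, -⟩ ⟨⟨b, hb, hbp⟩, -⟩
    have h1 : T (timeShift (-i) a) = p := by
      rw [hT, (H.collisionMap_timeShift (hA₀D ha) (-i)).2, ← hT, hap, timeShift_neg']
    have h2 : T (timeShift (-j) b) = p := by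
      rw [hT, (H.collisionMap_timeShift (hA₀D hb) (-j)).2, ← hT, hbp, timeShift_neg']
    have h3 := H.injOn_collisionMap (H.collisionMap_timeShift (hA₀D ha) (-i)).1
      (H.collisionMap_timeShift (hA₀D hb) (-j)).1 (h1.trans h2.symm)
    have h4 : timeShift (-i) a ∈ periodStrip (-i) := timeShift_mem_periodStrip.2 ha.2
    have h5 : timeShift (-j) b ∈ periodStrip (-j) := timeShift_mem_periodStrip.2 hb.2
    rw [h3] at h4
    exact hij (neg_injective (eq_of_mem_periodStrip h4 h5))
  calc fluxMeasure fL fR lam x₀ A₀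
      = fluxMeasure fL fR lam x₀ (T '' A₀) := (H.flux_image hA₀m hA₀D).symm
    _ = fluxMeasure fL fR lam x₀ (⋃ j, T '' A₀ ∩ periodStrip j) := by
        rw [← inter_iUnion, iUnion_periodStrip, inter_univ]
    _ = ∑' j, fluxMeasure fL fR lam x₀ (T '' A₀ ∩ periodStrip j) := measure_iUnion hEdisj hEm
    _ = ∑' j : ℤ, fluxMeasure fL fR lam x₀ (timeShift j ⁻¹' (T '' A₀ ∩ periodStrip j)) := by
        congr 1
        ext j
        rw [H.flux_preimage_timeShift j (hEm j)]
    _ = fluxMeasure fL fR lam x₀ (⋃ j : ℤ, timeShift j ⁻¹' (T '' A₀ ∩ periodStrip j)) :=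
        (measure_iUnion hCdisj hCm).symm
    _ ≤ fluxMeasure fL fR lam x₀ (B ∩ periodStrip 0) := by
        refine measure_mono (iUnion_subset fun j => ?_)
        rintro p ⟨⟨a, ha, hap⟩, hp⟩
        refine ⟨?_, timeShift_mem_periodStrip.1 hp⟩
        have h1 : T (timeShift (-j) a) = p := by
          rw [hT, (H.collisionMap_timeShift (hA₀D ha) (-j)).2, ← hT, hap, timeShift_neg']
        rw [← h1]
        exact hAB _ (hAinv a ha.1 (-j))

theorem ae_iterate_mem : ∀ᵐ p : ℝ × ℝ, ∀ n,
    (collisionMap fL fR lam x₀)^[n] p ∈ nextDomain fL fR lam x₀ := by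
  rw [ae_all_iff]
  intro n
  induction n with
  | zero => exact H.ae_mem_nextDomain
  | succ n ih =>
    filter_upwards [H.ae_collisionMap ih] with p hp
    rwa [Function.iterate_succ_apply]

theorem ae_iterate {Q : ℝ × ℝ → Prop} (hQ : ∀ᵐ p, Q p) :
    ∀ᵐ p, ∀ n, Q ((collisionMap fL fR lam x₀)^[n] p) := by
  rw [ae_all_iff]
  intro n
  induction n with
  | zero => exact hQ
  | succ n ih =>
    filter_upwards [H.ae_collisionMap ih] with p hp
    rwa [Function.iterate_succ_apply]

theorem iterate_timeShift {p : ℝ × ℝ}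
    (hp : ∀ n, (collisionMap fL fR lam x₀)^[n] p ∈ nextDomain fL fR lam x₀) (k : ℤ) (n : ℕ) :
    (collisionMap fL fR lam x₀)^[n] (timeShift k p) =
      timeShift k ((collisionMap fL fR lam x₀)^[n] p) := by
  induction n with
  | zero => rfl
  | succ n ih =>
    rw [Function.iterate_succ_apply', ih, (H.collisionMap_timeShift (hp n) k).2,
      Function.iterate_succ_apply']

/-- Almost no orbit enters the region of speeds at most `V` for good: the set of the orbits that
stay in this region has finite measure per period, hence the collision map cannot send it together
with a set of positive measure into itself. -/
theorem ae_not_last_above (V : ℝ) : ∀ᵐ p : ℝ × ℝ, V < |p.2| →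
    ∃ n, V < |((collisionMap fL fR lam x₀)^[n + 1] p).2| := by
  set T := collisionMap fL fR lam x₀ with hT
  set A : Set (ℝ × ℝ) := {p | (∀ n, T^[n] p ∈ nextDomain fL fR lam x₀) ∧
    ∀ n, |(T^[n + 1] p).2| ≤ V} with hA
  set M : Set (ℝ × ℝ) := A ∩ {p | |p.2| ≤ V} with hM
  have mT : ∀ n, Measurable (T^[n]) := fun n => H.measurable_collisionMap.iterate n
  have mA : MeasurableSet A := by
    have h1 : MeasurableSet {p | ∀ n, T^[n] p ∈ nextDomain fL fR lam x₀} := by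
      rw [ofPred_forall]
      exact MeasurableSet.iInter fun n => mT n H.isOpen_nextDomain.measurableSet
    have h2 : MeasurableSet {p | ∀ n, |(T^[n + 1] p).2| ≤ V} := by
      rw [ofPred_forall]
      exact MeasurableSet.iInter fun n => measurableSet_le (mT (n + 1)).snd.norm measurable_const
    exact h1.inter h2
  have mV : MeasurableSet {p : ℝ × ℝ | |p.2| ≤ V} :=
    measurableSet_le measurable_snd.norm measurable_const
  have hAinv : ∀ p ∈ A, ∀ k, timeShift k p ∈ A := by
    intro p hp k
    refine ⟨fun n => ?_, fun n => ?_⟩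
    · rw [hT, H.iterate_timeShift hp.1]
      exact (H.collisionMap_timeShift (hp.1 n) k).1
    · rw [hT, H.iterate_timeShift hp.1]
      exact hp.2 n
  have hAB : ∀ p ∈ A, T p ∈ M := by
    intro p hp
    refine ⟨⟨fun n => ?_, fun n => ?_⟩, ?_⟩
    · rw [← Function.iterate_succ_apply]; exact hp.1 (n + 1)
    · rw [← Function.iterate_succ_apply]; exact hp.2 (n + 1)
    · exact hp.2 0
  have hle := H.flux_periodStrip_le mA (fun p hp => hp.1 0) hAinv hAB
  have hfin : fluxMeasure fL fR lam x₀ (M ∩ periodStrip 0) < ⊤ := by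
    obtain ⟨m, -, K, -, bL, bR⟩ := H.exists_bounds
    have hsub : M ∩ periodStrip 0 ⊆ Icc (0 : ℝ) 2 ×ˢ Icc (-V) V := by
      rintro p ⟨⟨-, hp⟩, h1, h2⟩
      simp only [Int.cast_zero, mul_zero, zero_add] at h1 h2
      exact ⟨⟨h1, h2.le⟩, abs_le.1 hp⟩
    have mS : MeasurableSet (Icc (0 : ℝ) 2 ×ˢ Icc (-V) V) := measurableSet_Icc.prod measurableSet_Icc
    refine (measure_mono hsub).trans_lt ?_
    rw [fluxMeasure, withDensity_apply _ mS]
    refine (setLIntegral_mono (g := fun _ => ENNReal.ofReal (V + K)) measurable_const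
      fun p hp => ?_).trans_lt ?_
    · refine ENNReal.ofReal_le_ofReal ((abs_sub _ _).trans (add_le_add (abs_le.2 hp.2) ?_))
      rw [slitVel_eq]
      exact (slitBounds_slitFn bL bR p.1).deriv_le _
    · rw [setLIntegral_const]
      refine ENNReal.mul_lt_top ENNReal.ofReal_lt_top ?_
      exact (isCompact_Icc.prod isCompact_Icc).measure_lt_top
  have hzero : fluxMeasure fL fR lam x₀ ((A \ M) ∩ periodStrip 0) = 0 := by
    have hsplit : A ∩ periodStrip 0 = (M ∩ periodStrip 0) ∪ ((A \ M) ∩ periodStrip 0) := by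
      rw [← union_inter_distrib_right, union_sdiff_cancel inter_subset_left]
    have hd : Disjoint (M ∩ periodStrip 0) ((A \ M) ∩ periodStrip 0) :=
      disjoint_sdiff_right.mono inter_subset_left inter_subset_left
    rw [hsplit, measure_union hd ((mA.diff (mA.inter mV)).inter (measurableSet_periodStrip 0))] at hle
    by_contra h0
    exact absurd hle (not_le.2 (ENNReal.lt_add_right hfin.ne h0))
  have hnull : fluxMeasure fL fR lam x₀ (A \ M) = 0 := by
    have : A \ M = ⋃ k, (A \ M) ∩ periodStrip k := by
      rw [← inter_iUnion, iUnion_periodStrip, inter_univ]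
    rw [this, measure_iUnion_null_iff]
    intro k
    have mk : MeasurableSet ((A \ M) ∩ periodStrip k) :=
      (mA.diff (mA.inter mV)).inter (measurableSet_periodStrip k)
    rw [← H.flux_preimage_timeShift k mk]
    refine measure_mono_null ?_ hzero
    rintro p ⟨⟨h1, h2⟩, h3⟩
    have h4 := hAinv _ h1 (-k)
    rw [timeShift_neg'] at h4
    exact ⟨⟨h4, fun h5 => h2 ⟨h1, h5.2⟩⟩, timeShift_mem_periodStrip.1 h3⟩
  rw [H.flux_eq_zero_iff] at hnull
  filter_upwards [H.ae_iterate_mem, measure_eq_zero_iff_ae_notMem.1 hnull] with p h1 h2 h3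
  by_contra h4
  push Not at h4
  exact h2 ⟨⟨h1, h4⟩, fun h5 => absurd h5.2 (not_le.2 h3)⟩

end LowerTrap

end

/-! ### Flights at high speed -/

theorem SlitBounds.sub_le {m M : ℝ} {f : ℝ → ℝ} (h : SlitBounds m M f) (s t : ℝ) :
    |f s - f t| ≤ M * |s - t| :=
  convex_univ.norm_image_sub_le_of_norm_deriv_le (𝕜 := ℝ)
    (fun x _ => h.differentiable x) (fun x _ => h.deriv_le x) (mem_univ t) (mem_univ s)

theorem SlitBounds.one_sub {m M : ℝ} {f : ℝ → ℝ} (h : SlitBounds m M f) :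
    SlitBounds m M (fun t => 1 - f t) where
  lower t := by have := h.upper t; linarith
  upper t := by have := h.lower t; linarith
  deriv_le t := by rw [deriv_const_sub, abs_neg]; exact h.deriv_le t
  deriv_lip s t := by
    rw [deriv_const_sub, deriv_const_sub, neg_sub_neg, abs_sub_comm]
    exact h.deriv_lip s t
  differentiable := h.differentiable.const_sub 1

section

variable {fL fR : ℝ → ℝ} {lam x₀ : ℝ}

namespace LowerTrap

variable (H : LowerTrap fL fR lam x₀)
include H

/-- A fast ball that leaves a slit downwards is reflected once by the floor and then meets a slit
from below. -/
theorem next_of_downward {m M : ℝ} (bL : SlitBounds m M fL) (bR : SlitBounds m M fR)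
    {p q : ℝ × ℝ} (hp : IsCollisionState fL fR lam x₀ p)
    (hpq : IsNextCollision fL fR lam x₀ p q) (hx : xPos x₀ q.1 ≠ lam) (hM : 0 ≤ M)
    (hv : p.2 < -M) :
    -p.2 * (q.1 - p.1) = slitFn fL fR lam x₀ p.1 p.1 + slitFn fL fR lam x₀ q.1 q.1 ∧
      q.2 = 2 * deriv (slitFn fL fR lam x₀ q.1) q.1 + p.2 := by
  have bp := slitBounds_slitFn (lam := lam) (x₀ := x₀) bL bR p.1
  have bq := slitBounds_slitFn (lam := lam) (x₀ := x₀) bL bR q.1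
  have hhm := H.slitFn_mem p.1 p.1
  have hU := unfolded_eq (fL := fL) (fR := fR) (lam := lam) (x₀ := x₀) p
  set f := slitFn fL fR lam x₀ p.1 with hf
  set g := slitFn fL fR lam x₀ q.1 with hg
  set y := flightHeight fL fR lam x₀ p with hy
  have hyc : Continuous y := continuous_flightHeight p
  have hv0 : p.2 < 0 := by linarith
  have hvn : p.2 ≠ 0 := hv0.ne
  have hyU : ∀ s, p.1 ≤ s → 0 ≤ f p.1 + p.2 * (s - p.1) → y s = f p.1 + p.2 * (s - p.1) := by
    intro s hs h0
    have : p.2 * (s - p.1) ≤ 0 := mul_nonpos_of_nonpos_of_nonneg hv0.le (by linarith)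
    rw [hy, flightHeight, hU, fold_of_abs_le (abs_le.2 ⟨by linarith, by linarith [hhm.2]⟩),
      abs_of_nonneg h0]
  have hstart : ∀ᶠ s in 𝓝[>] p.1, IsBelow fL fR lam x₀ s (y s) := by
    have e1 := (eventually_slitFn_eq (fL := fL) (fR := fR) hp.1).filter_mono (nhdsWithin_le_nhds (s := Ioi p.1))
    have e2 : ∀ᶠ s in 𝓝[>] p.1, 0 < f p.1 + p.2 * (s - p.1) := by
      have hc : ContinuousAt (fun s => f p.1 + p.2 * (s - p.1)) p.1 := by fun_prop
      exact (continuousAt_const.eventually_lt hc (by simpa using hhm.1)).filter_mono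
        nhdsWithin_le_nhds
    filter_upwards [e1, e2, self_mem_nhdsWithin] with s h1 h2 h3
    have h3' : 0 < s - p.1 := by have := mem_Ioi.1 h3; linarith
    rw [isBelow_iff h1.1, h1.2, hyU s (by linarith) h2.le]
    have h4 := abs_le.1 (bp.sub_le s p.1)
    rw [abs_of_pos h3'] at h4
    nlinarith [h4.1]
  have hbelow : ∀ s ∈ Ioo p.1 q.1, IsBelow fL fR lam x₀ s (y s) := by
    intro s hs
    obtain ⟨a, ha, has⟩ := (hstart.and (Ioo_mem_nhdsGT hs.1)).exists
    refine H.isBelow_of_no_touch hyc has.2.le ha fun z hz => ?_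
    exact hpq.2.1 z ⟨has.1.trans_le hz.1, hz.2.trans_lt hs.2⟩
  have hUq : -1 < f p.1 + p.2 * (q.1 - p.1) := by
    by_contra hcon
    push Not at hcon
    set s := p.1 + (-1 - f p.1) / p.2 with hs
    have hsp : p.1 < s := by
      have : 0 < (-1 - f p.1) / p.2 := div_pos_of_neg_of_neg (by linarith [hhm.1]) hv0
      linarith
    have hUs : f p.1 + p.2 * (s - p.1) = -1 := by
      rw [hs]; field_simp; ring
    have hsq : s ≤ q.1 := by nlinarith
    have hys : y s = 1 := by
      rw [hy, flightHeight, hU, hUs, fold_of_abs_le (by simp)]; simp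
    rcases hsq.lt_or_eq with h | h
    · have := hbelow s ⟨hsp, h⟩
      rw [hys] at this
      exact H.not_isBelow_one s this
    · have := H.touches_mem hpq.2.2.1
      rw [← h] at this
      exact absurd this.2 (by rw [← hy, hys]; exact lt_irrefl _)
  have hUq' : f p.1 + p.2 * (q.1 - p.1) < 0 := by
    by_contra hcon
    push Not at hcon
    have e1 := (eventually_slitFn_eq (fL := fL) (fR := fR) hx).filter_mono (nhdsWithin_le_nhds (s := Iio q.1))
    obtain ⟨s, h1, h2⟩ := (e1.and (Ioo_mem_nhdsLT hpq.1)).exists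
    have h3 := hbelow s h2
    rw [isBelow_iff h1.1, h1.2, hyU s h2.1.le (by nlinarith [h2.2])] at h3
    have h4 : y q.1 = g q.1 := (touches_iff hx).1 hpq.2.2.1
    rw [hyU q.1 hpq.1.le hcon] at h4
    have h5 := abs_le.1 (bq.sub_le s q.1)
    have h6 : 0 < q.1 - s := by linarith [h2.2]
    rw [abs_sub_comm s, abs_of_pos h6] at h5
    nlinarith [h5.2]
  have hfl : ⌊unfolded fL fR lam x₀ p q.1⌋ = -1 := by
    rw [hU, Int.floor_eq_iff]
    push_cast
    constructor <;> linarith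
  have hyq := (touches_iff hx).1 hpq.2.2.1
  rw [flightHeight, hU, fold_of_abs_le (abs_le.2 ⟨hUq.le, by linarith⟩), abs_of_neg hUq'] at hyq
  refine ⟨by linarith, ?_⟩
  rw [hpq.2.2.2, slitVel_eq, flightVel, hfl, ← hg]
  norm_num

/-- A fast ball that meets a slit from above has left a slit upwards and has been reflected once by
the ceiling. -/
theorem prev_of_upward {m M : ℝ} (bL : SlitBounds m M fL) (bR : SlitBounds m M fR)
    {p q : ℝ × ℝ} (hp : IsCollisionState fL fR lam x₀ p)
    (hpq : IsNextCollision fL fR lam x₀ p q) (hx : xPos x₀ q.1 ≠ lam) (hM : 0 ≤ M)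
    (hv : M < |p.2|) (hvq : 2 * M < q.2) :
    p.2 * (q.1 - p.1) = (1 - slitFn fL fR lam x₀ p.1 p.1) + (1 - slitFn fL fR lam x₀ q.1 q.1) ∧
      q.2 = 2 * deriv (slitFn fL fR lam x₀ q.1) q.1 + p.2 := by
  have bq := slitBounds_slitFn (lam := lam) (x₀ := x₀) bL bR q.1
  have hdq := abs_le.1 (bq.deriv_le q.1)
  have hv0 : 0 < p.2 := by
    by_contra h
    push Not at h
    rw [abs_of_nonpos h] at hv
    have := (H.next_of_downward bL bR hp hpq hx hM (by linarith)).2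
    linarith [hdq.2]
  have hhm := H.slitFn_mem p.1 p.1
  have hq2 := hpq.2.2.2
  have hyq := (touches_iff hx).1 hpq.2.2.1
  rw [slitVel_eq, flightVel] at hq2
  have hU := unfolded_eq (fL := fL) (fR := fR) (lam := lam) (x₀ := x₀) p
  have hn0 : 0 < unfolded fL fR lam x₀ p q.1 := by
    have : 0 < p.2 * (q.1 - p.1) := mul_pos hv0 (by linarith [hpq.1])
    rw [hU]; linarith [hhm.1]
  have hodd : Odd ⌊unfolded fL fR lam x₀ p q.1⌋ := by
    by_contra h
    rw [(Int.not_odd_iff_even.1 h).neg_one_zpow] at hq2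
    linarith [hdq.2]
  have hlt3 : unfolded fL fR lam x₀ p q.1 < 3 := by
    by_contra hcon
    push Not at hcon
    have hUc : ∀ c : ℝ, unfolded fL fR lam x₀ p
        (p.1 + (c - slitFn fL fR lam x₀ p.1 p.1) / p.2) = c := by
      intro c; rw [hU]; field_simp; ring
    set h := slitFn fL fR lam x₀ p.1 p.1
    have h2 : 0 < (2 - h) / p.2 := div_pos (by linarith [hhm.2]) hv0
    have h23 : (2 - h) / p.2 ≤ (3 - h) / p.2 :=
      div_le_div_of_nonneg_right (by linarith) hv0.le
    have h3q : (3 - h) / p.2 ≤ q.1 - p.1 := by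
      rw [div_le_iff₀ hv0]
      rw [hU] at hcon
      linarith
    have hy2 : flightHeight fL fR lam x₀ p (p.1 + (2 - h) / p.2) = 0 := by
      rw [flightHeight, hUc, fold_even (k := 1) (by norm_num) (by norm_num)]; norm_num
    have hy3 : flightHeight fL fR lam x₀ p (p.1 + (3 - h) / p.2) = 1 := by
      rw [flightHeight, hUc, fold_even (k := 1) (by norm_num) (by norm_num)]; norm_num
    obtain ⟨s, hs, ht⟩ := H.exists_touch_of_zero_of_one (continuous_flightHeight p)
      (by linarith) hy2 hy3
    rcases (show s ≤ q.1 by linarith [hs.2]).lt_or_eq with hsq | hsq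
    · exact hpq.2.1 s ⟨by linarith [hs.1], hsq⟩ ht
    · have hs3 : s = p.1 + (3 - h) / p.2 := le_antisymm hs.2 (by linarith)
      have := H.touches_mem ht
      rw [hs3, hy3] at this
      exact lt_irrefl _ this.2
  have hfl : ⌊unfolded fL fR lam x₀ p q.1⌋ = 1 := by
    have h1 : 0 ≤ ⌊unfolded fL fR lam x₀ p q.1⌋ := Int.floor_nonneg.2 hn0.le
    have h2 : ⌊unfolded fL fR lam x₀ p q.1⌋ < 3 := Int.floor_lt.2 (by exact_mod_cast hlt3)
    obtain ⟨k, hk⟩ := hodd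
    omega
  have hb := Int.floor_eq_iff.1 hfl
  push_cast at hb
  rw [flightHeight, fold_odd (k := 0) (by push_cast; linarith [hb.1])
    (by push_cast; linarith [hb.2]), hU] at hyq
  rw [hfl] at hq2
  push_cast at hyq
  refine ⟨by linarith, by rw [hq2]; norm_num⟩

end LowerTrap

/-! ### Counting the crossings -/

/-- The number of crossings of `x = lam` up to time `t`, up to an additive constant. -/
noncomputable def crossingCount (lam x₀ t : ℝ) : ℤ :=
  ⌊(x₀ + t - lam) / 2⌋ + ⌊(x₀ + t + lam) / 2⌋

theorem crossingCount_sub_ge (t t' : ℝ) :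
    t' - t - 2 ≤ (crossingCount lam x₀ t' : ℝ) - crossingCount lam x₀ t := by
  unfold crossingCount
  push_cast
  linarith [Int.floor_le ((x₀ + t - lam) / 2), Int.floor_le ((x₀ + t + lam) / 2),
    Int.lt_floor_add_one ((x₀ + t' - lam) / 2), Int.lt_floor_add_one ((x₀ + t' + lam) / 2)]

theorem crossingCount_sub_le (t t' : ℝ) :
    (crossingCount lam x₀ t' : ℝ) - crossingCount lam x₀ t ≤ t' - t + 2 := by
  have := crossingCount_sub_ge (lam := lam) (x₀ := x₀) t' t
  linarith

theorem crossingCount_cases (h0 : 0 < lam) (h1 : lam < 1) (t : ℝ) : ∃ k : ℤ,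
    (2 * k - lam ≤ x₀ + t ∧ x₀ + t < 2 * k + lam ∧ crossingCount lam x₀ t = 2 * k - 1 ∧
      xPos x₀ t ≤ lam) ∨
    (2 * k + lam ≤ x₀ + t ∧ x₀ + t < 2 * k + 2 - lam ∧ crossingCount lam x₀ t = 2 * k ∧
      lam ≤ xPos x₀ t) := by
  refine ⟨⌊(x₀ + t + lam) / 2⌋, ?_⟩
  have h2 := Int.floor_le ((x₀ + t + lam) / 2)
  have h3 := Int.lt_floor_add_one ((x₀ + t + lam) / 2)
  unfold crossingCount xPos
  set k := ⌊(x₀ + t + lam) / 2⌋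
  set z := x₀ + t
  rcases lt_or_ge z (2 * k + lam) with h | h
  · left
    have ha : ⌊(z - lam) / 2⌋ = k - 1 := by
      rw [Int.floor_eq_iff]; push_cast; constructor <;> linarith
    refine ⟨by linarith, h, by rw [ha]; ring, ?_⟩
    have he := fold_add_two_mul (z - 2 * k) k
    rw [sub_add_cancel] at he
    have habs : |z - 2 * k| ≤ lam := abs_le.2 ⟨by linarith, by linarith⟩
    rw [he, fold_of_abs_le (habs.trans h1.le)]
    exact habs
  · right
    have ha : ⌊(z - lam) / 2⌋ = k := by
      rw [Int.floor_eq_iff]; constructor <;> linarith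
    refine ⟨h, by linarith, by rw [ha]; ring, ?_⟩
    rcases le_total z (2 * k + 1) with h4 | h4
    · rw [fold_even (k := k) (by linarith) h4]; linarith
    · rw [fold_odd (k := k) h4 (by linarith)]; linarith

/-- Two times that are closer than two consecutive crossings are separated by no crossing or by
exactly one. -/
theorem crossing_between (h0 : 0 < lam) (h1 : lam < 1) {t t' : ℝ} (htt : t < t')
    (hl : t' - t < 2 * lam) (hr : t' - t < 2 * (1 - lam)) (hx : xPos x₀ t ≠ lam)
    (hx' : xPos x₀ t' ≠ lam) :
    (crossingCount lam x₀ t' = crossingCount lam x₀ t ∧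
      slitFn fL fR lam x₀ t' = slitFn fL fR lam x₀ t) ∨
    (crossingCount lam x₀ t' = crossingCount lam x₀ t + 1 ∧ ∃ k : ℤ,
      (2 * k + (lam - x₀) ∈ Ioo t t' ∧ slitFn fL fR lam x₀ t = fL ∧
        slitFn fL fR lam x₀ t' = fR) ∨
      (2 * k + (2 - lam - x₀) ∈ Ioo t t' ∧ slitFn fL fR lam x₀ t = fR ∧
        slitFn fL fR lam x₀ t' = fL)) := by
  have hleft : ∀ {s}, xPos x₀ s ≤ lam → xPos x₀ s ≠ lam → slitFn fL fR lam x₀ s = fL := by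
    intro s h h'
    simp [slitFn, lt_of_le_of_ne h h']
  have hright : ∀ {s}, lam ≤ xPos x₀ s → slitFn fL fR lam x₀ s = fR := by
    intro s h
    simp [slitFn, h.not_gt]
  obtain ⟨k, ⟨a1, a2, a3, a4⟩ | ⟨a1, a2, a3, a4⟩⟩ := crossingCount_cases (x₀ := x₀) h0 h1 t <;>
  obtain ⟨k', ⟨b1, b2, b3, b4⟩ | ⟨b1, b2, b3, b4⟩⟩ := crossingCount_cases (x₀ := x₀) h0 h1 t'
  · have e1 : (k' : ℝ) < k + 1 := by linarith
    have e2 : (k : ℝ) < k' + 1 := by linarith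
    have e : k' = k := by
      have e1' : k' < k + 1 := by exact_mod_cast e1
      have e2' : k < k' + 1 := by exact_mod_cast e2
      omega
    left
    exact ⟨by rw [a3, b3, e], by rw [hleft a4 hx, hleft b4 hx']⟩
  · have e1 : (k' : ℝ) < k + 1 := by linarith
    have e2 : (k : ℝ) < k' + 1 := by linarith
    have e : k' = k := by
      have e1' : k' < k + 1 := by exact_mod_cast e1
      have e2' : k < k' + 1 := by exact_mod_cast e2
      omega
    subst e
    right
    refine ⟨by rw [a3, b3]; ring, k', Or.inl ⟨⟨by linarith, ?_⟩, hleft a4 hx, hright b4⟩⟩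
    rcases (show 2 * (k' : ℝ) + (lam - x₀) ≤ t' by linarith).lt_or_eq with h | h
    · exact h
    · exact absurd (show xPos x₀ t' = lam by
        rw [xPos, fold_even (k := k') (by linarith) (by linarith)]; linarith) hx'
  · have e1 : (k' : ℝ) < k + 2 := by linarith
    have e2 : (k : ℝ) < k' := by linarith
    have e : k' = k + 1 := by
      have e1' : k' < k + 2 := by exact_mod_cast e1
      have e2' : k < k' := by exact_mod_cast e2
      omega
    subst e
    push_cast at b1 b2
    right
    refine ⟨by rw [a3, b3]; ring, k, Or.inr ⟨⟨by linarith, ?_⟩, hright a4, hleft b4 hx'⟩⟩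
    rcases (show 2 * (k : ℝ) + (2 - lam - x₀) ≤ t' by linarith).lt_or_eq with h | h
    · exact h
    · exact absurd (show xPos x₀ t' = lam by
        rw [xPos, fold_odd (k := k) (by linarith) (by linarith)]; linarith) hx'
  · have e1 : (k' : ℝ) < k + 1 := by linarith
    have e2 : (k : ℝ) < k' + 1 := by linarith
    have e : k' = k := by
      have e1' : k' < k + 1 := by exact_mod_cast e1
      have e2' : k < k' + 1 := by exact_mod_cast e2
      omega
    left
    exact ⟨by rw [a3, b3, e], by rw [hright a4, hright b4]⟩

/-! ### The adiabatic invariant -/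

/-- The adiabatic invariant of a ball that leaves, at time `t` with speed `u`, a slit at distance
`d t` from the wall that it moves to: the product of the relative speed and of the distance. -/
noncomputable def action (d : ℝ → ℝ) (t u : ℝ) : ℝ := (u + deriv d t) * d t

theorem le_action {m M : ℝ} {d : ℝ → ℝ} (b : SlitBounds m M d) (hm : 0 < m) {t u : ℝ}
    (hu : M ≤ u) : (u - M) * m ≤ action d t u := by
  have h1 := (abs_le.1 (b.deriv_le t)).1
  exact mul_le_mul (by linarith) (b.lower t) hm.le (by linarith)

theorem action_le {m M : ℝ} {d : ℝ → ℝ} (b : SlitBounds m M d) (hm : 0 < m) {t u : ℝ}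
    (hu : M ≤ u) : action d t u ≤ u + M := by
  have h1 := abs_le.1 (b.deriv_le t)
  have h2 := b.upper t
  calc action d t u ≤ (u + deriv d t) * 1 :=
        mul_le_mul_of_nonneg_left (by linarith) (by linarith [h1.1])
    _ ≤ u + M := by linarith [h1.2]

/-- During a flight from a slit to the wall and back, the action varies by an amount of the order of
the duration of the flight, uniformly in the speed: the change of the relative speed compensates that
of the distance to first order. -/
theorem abs_action_sub_le {m M : ℝ} {d : ℝ → ℝ} (b : SlitBounds m M d) (hm : 0 < m) {t t' u : ℝ}
    (htt : t < t') (hδ : u * (t' - t) = d t + d t') :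
    |(u - deriv d t') * d t' - action d t u| ≤ 3 * M * (t' - t) := by
  have hpos : 0 < t' - t := by linarith
  obtain ⟨ξ, hξ, hslope⟩ := exists_deriv_eq_slope d htt b.differentiable.continuous.continuousOn
    b.differentiable.differentiableOn
  rw [eq_div_iff hpos.ne'] at hslope
  have hM : 0 ≤ M := (abs_nonneg _).trans (b.deriv_le t)
  have l1 : |deriv d ξ - deriv d t| ≤ M * (t' - t) := by
    refine (b.deriv_lip ξ t).trans (mul_le_mul_of_nonneg_left ?_ hM)
    rw [abs_of_pos (by linarith [hξ.1])]; linarith [hξ.2]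
  have l2 : |deriv d t - deriv d t'| ≤ M * (t' - t) := by
    have := b.deriv_lip t t'
    rwa [abs_sub_comm t, abs_of_pos hpos] at this
  have d1 : d t ≤ 1 := by linarith [b.upper t]
  have d2 : d t' ≤ 1 := by linarith [b.upper t']
  have d3 : 0 < d t' := hm.trans_le (b.lower t')
  have d4 : 0 < d t := hm.trans_le (b.lower t)
  have e : (u - deriv d t') * d t' - action d t u =
      (u * (t' - t)) * (deriv d ξ - deriv d t) + (deriv d t - deriv d t') * d t' := by
    unfold action
    have : d t' = d t + deriv d ξ * (t' - t) := by linarith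
    linear_combination (u : ℝ) * this + deriv d t * hδ
  rw [e, hδ]
  refine (abs_add_le _ _).trans ?_
  rw [abs_mul, abs_mul, abs_of_pos (show 0 < d t + d t' by linarith), abs_of_pos d3]
  have m1 : (d t + d t') * |deriv d ξ - deriv d t| ≤ 2 * (M * (t' - t)) :=
    mul_le_mul (by linarith) l1 (abs_nonneg _) (by norm_num)
  have m2 : |deriv d t - deriv d t'| * d t' ≤ M * (t' - t) * 1 :=
    mul_le_mul l2 d2 d3.le (by positivity)
  linarith

/-- During a flight from the slit at distance `d` to the one at distance `e` from the wall, with a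
crossing at time `c`, the actions are those of a ball of constant speed at time `c`, up to a bounded
error. -/
theorem abs_action_sub_le_of_crossing {m M : ℝ} {d e : ℝ → ℝ} (bd : SlitBounds m M d)
    (be : SlitBounds m M e) (hm : 0 < m) {t t' c u : ℝ} (hc : c ∈ Ioo t t') (hu : 0 ≤ u)
    (hδ : u * (t' - t) = d t + e t') :
    |action d t u - u * d c| ≤ 3 * M ∧ |(u - deriv e t') * e t' - u * e c| ≤ 3 * M := by
  have hM : 0 ≤ M := (abs_nonneg _).trans (bd.deriv_le t)
  have hu2 : u * (t' - t) ≤ 2 := by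
    rw [hδ]; linarith [bd.upper t, be.upper t']
  have key : ∀ (f : ℝ → ℝ) (s σ : ℝ), SlitBounds m M f → |s - c| ≤ t' - t → |σ| ≤ M →
      |u * (f s - f c) + σ * f s| ≤ 3 * M := by
    intro f s σ bf hs hσ
    have f1 : f s ≤ 1 := by linarith [bf.upper s]
    have f2 : 0 < f s := hm.trans_le (bf.lower s)
    refine (abs_add_le _ _).trans ?_
    rw [abs_mul, abs_mul, abs_of_nonneg hu, abs_of_pos f2]
    have m1 : u * |f s - f c| ≤ u * (M * (t' - t)) :=
      mul_le_mul_of_nonneg_left ((bf.sub_le s c).trans (mul_le_mul_of_nonneg_left hs hM)) hu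
    have m2 : |σ| * f s ≤ M * 1 := mul_le_mul hσ f1 f2.le hM
    have m3 : M * (u * (t' - t)) ≤ M * 2 := mul_le_mul_of_nonneg_left hu2 hM
    linarith
  constructor
  · have := key d t (deriv d t) bd
      (by rw [abs_sub_comm, abs_of_pos (by linarith [hc.1])]; linarith [hc.2]) (bd.deriv_le t)
    convert this using 2
    unfold action; ring
  · have := key e t' (-deriv e t') be
      (by rw [abs_of_pos (by linarith [hc.2])]; linarith [hc.1]) (by rw [abs_neg]; exact be.deriv_le t')
    convert this using 2
    ring

/-- The constants of the analysis at high speed: `m` and `M` bound the slits, the distances to the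
slits jump by a factor of at least `γ` at the crossings, `ζ` is the resulting rate of growth, and
the analysis applies to the speeds above `V₀`. At these speeds a flight takes less time than the
time between two crossings (`gap_left`, `gap_right`), the error of the adiabatic invariant during a
flight is absorbed by the rate `ζ` (`drift_le`), and the error at a crossing is absorbed by
replacing `γ` with `(1 + γ) / 2 = exp (2 * ζ)` (`jump_le`). -/
structure SpeedConstants (fL fR : ℝ → ℝ) (lam x₀ m M γ ζ V₀ : ℝ) : Prop where
  m_pos : 0 < m
  one_le_M : 1 ≤ M
  bL : SlitBounds m M fL
  bR : SlitBounds m M fR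
  one_lt_gamma : 1 < γ
  lower_rightward : γ * fL (lam - x₀) ≤ fR (lam - x₀)
  upper_rightward : γ * (1 - fR (lam - x₀)) ≤ 1 - fL (lam - x₀)
  lower_leftward : γ * fR (2 - lam - x₀) ≤ fL (2 - lam - x₀)
  upper_leftward : γ * (1 - fL (2 - lam - x₀)) ≤ 1 - fR (2 - lam - x₀)
  zeta_pos : 0 < ζ
  exp_zeta : Real.exp (2 * ζ) = (1 + γ) / 2
  three_M_le : 3 * M ≤ V₀
  drift_le : 3 * M ≤ ζ * ((V₀ - M) * m)
  jump_le : 3 * M * (γ + 1) ≤ (γ - 1) / 2 * ((V₀ - M) * m)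
  gap_left : 1 < V₀ * lam
  gap_right : 1 < V₀ * (1 - lam)

theorem LowerTrap.exists_speedConstants (H : LowerTrap fL fR lam x₀) :
    ∃ m M γ ζ V₀ : ℝ, SpeedConstants fL fR lam x₀ m M γ ζ V₀ := by
  obtain ⟨m, hm, M, hM, bL, bR⟩ := H.exists_bounds
  have ratio : ∀ a b : ℝ, 0 < a → a < b → ∃ γ > 1, ∀ γ' ≤ γ, γ' * a ≤ b := by
    intro a b ha hab
    refine ⟨b / a, by rwa [gt_iff_lt, lt_div_iff₀ ha, one_mul], fun γ' h => ?_⟩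
    exact (le_div_iff₀ ha).1 h
  obtain ⟨γ₁, h₁, k₁⟩ := ratio _ _ (H.left_mem (lam - x₀)).1 H.jump_rightward
  obtain ⟨γ₂, h₂, k₂⟩ := ratio (1 - fR (lam - x₀)) (1 - fL (lam - x₀))
    (by linarith [(H.right_mem (lam - x₀)).2]) (by linarith [H.jump_rightward])
  obtain ⟨γ₃, h₃, k₃⟩ := ratio _ _ (H.right_mem (2 - lam - x₀)).1 H.jump_leftward
  obtain ⟨γ₄, h₄, k₄⟩ := ratio (1 - fL (2 - lam - x₀)) (1 - fR (2 - lam - x₀))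
    (by linarith [(H.left_mem (2 - lam - x₀)).2]) (by linarith [H.jump_leftward])
  obtain ⟨γ, hγ, g1, g2, g3, g4⟩ : ∃ γ > 1, γ ≤ γ₁ ∧ γ ≤ γ₂ ∧ γ ≤ γ₃ ∧ γ ≤ γ₄ :=
    ⟨min (min γ₁ γ₂) (min γ₃ γ₄), lt_min (lt_min h₁ h₂) (lt_min h₃ h₄), by simp, by simp, by simp,
      by simp⟩
  have hζ : 0 < Real.log ((1 + γ) / 2) / 2 := by
    have := Real.log_pos (show 1 < (1 + γ) / 2 by linarith)
    linarith
  set ζ := Real.log ((1 + γ) / 2) / 2 with hζdef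
  have big : ∀ {c : ℝ} (C : ℝ), 0 < c → ∀ᶠ V in atTop, C ≤ c * V := fun C hc =>
    (tendsto_id.const_mul_atTop hc).eventually_ge_atTop C
  obtain ⟨V₀, ⟨v1, v2⟩, v3, v4, v5⟩ :=
    (((big (3 * M) one_pos).and (big (3 * M + ζ * M * m) (mul_pos hζ hm))).and
      ((big (3 * M * (γ + 1) + (γ - 1) / 2 * M * m)
        (mul_pos (show 0 < (γ - 1) / 2 by linarith) hm)).and
      ((big 2 H.lam_pos).and (big 2 (show 0 < 1 - lam by linarith [H.lam_lt_one]))))).exists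
  exact ⟨m, M, γ, ζ, V₀, hm, hM, bL, bR, hγ, k₁ γ g1, k₂ γ g2, k₃ γ g3, k₄ γ g4, hζ,
    by rw [hζdef, mul_div_cancel₀ _ two_ne_zero, Real.exp_log (by linarith)],
    by linarith, by linarith, by linarith, by linarith, by linarith⟩

namespace SpeedConstants

variable {m M γ ζ V₀ : ℝ} (C : SpeedConstants fL fR lam x₀ m M γ ζ V₀)
include C

theorem action_pos : 0 < (V₀ - M) * m :=
  mul_pos (by linarith [C.three_M_le, C.one_le_M]) C.m_pos

theorem log_sub_log_le {X Y δ : ℝ} (hX : (V₀ - M) * m ≤ X) (hY : (V₀ - M) * m ≤ Y)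
    (hδ : 0 ≤ δ) (h : |Y - X| ≤ 3 * M * δ) : Real.log X - ζ * δ ≤ Real.log Y := by
  have hX0 := C.action_pos.trans_le hX
  have hY0 := C.action_pos.trans_le hY
  have h1 : Real.log (X / Y) ≤ X / Y - 1 := Real.log_le_sub_one_of_pos (div_pos hX0 hY0)
  rw [Real.log_div hX0.ne' hY0.ne'] at h1
  have h2 : X / Y - 1 ≤ ζ * δ := by
    rw [sub_le_iff_le_add, div_le_iff₀ hY0]
    have h3 := (abs_le.1 h).1
    have h4 : 3 * M * δ ≤ ζ * Y * δ := by
      refine mul_le_mul_of_nonneg_right (C.drift_le.trans ?_) hδ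
      exact mul_le_mul_of_nonneg_left hY C.zeta_pos.le
    linarith
  linarith

/-- An action that is multiplied by at least `γ` up to bounded errors is multiplied by at least
`exp (2 * ζ)` if it is large. -/
theorem log_add_le_of_jump {X Y x y : ℝ} (hX : (V₀ - M) * m ≤ X) (hXx : |X - x| ≤ 3 * M)
    (hYy : |Y - y| ≤ 3 * M) (hxy : γ * x ≤ y) : Real.log X + 2 * ζ ≤ Real.log Y := by
  have hX0 := C.action_pos.trans_le hX
  have h1 : Real.exp (2 * ζ) * X ≤ Y := by
    rw [C.exp_zeta]
    have h2 := abs_le.1 hXx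
    have h3 := abs_le.1 hYy
    have h4 : (γ - 1) / 2 * ((V₀ - M) * m) ≤ (γ - 1) / 2 * X :=
      mul_le_mul_of_nonneg_left hX (by linarith [C.one_lt_gamma])
    have h5 : γ * (X - 3 * M) ≤ γ * x :=
      mul_le_mul_of_nonneg_left (by linarith) (by linarith [C.one_lt_gamma])
    linarith [C.jump_le]
  have h2 := Real.log_le_log (mul_pos (Real.exp_pos _) hX0) h1
  rw [Real.log_mul (Real.exp_pos _).ne' hX0.ne', Real.log_exp] at h2
  linarith

theorem flight_short {δ u : ℝ} (hu : V₀ ≤ u) (h : u * δ ≤ 2) (hδ : 0 < δ)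
    (h0 : 0 < lam) (h1 : lam < 1) : δ < 2 * lam ∧ δ < 2 * (1 - lam) := by
  have h2 : V₀ * δ ≤ 2 := (mul_le_mul_of_nonneg_right hu hδ.le).trans h
  have hV : 0 < V₀ := by linarith [C.three_M_le, C.one_le_M]
  constructor
  · by_contra h3
    push Not at h3
    nlinarith [C.gap_left]
  · by_contra h3
    push Not at h3
    nlinarith [C.gap_right]

/-- Along a flight in the lower chamber, the logarithm of the action varies by at most `ζ` times
the duration of the flight, apart from a gain of at least `2 * ζ` and a bounded one at a
crossing. -/
theorem lower_step (H : LowerTrap fL fR lam x₀) {p q : ℝ × ℝ}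
    (hp : IsCollisionState fL fR lam x₀ p) (hpq : IsNextCollision fL fR lam x₀ p q)
    (hx : xPos x₀ q.1 ≠ lam) (hv : p.2 ≤ -V₀) :
    -p.2 * (q.1 - p.1) ≤ 2 ∧ 2 * m ≤ -p.2 * (q.1 - p.1) ∧ q.2 ≤ -M ∧
    Real.log (action (slitFn fL fR lam x₀ p.1) p.1 (-p.2)) +
      2 * ζ * ((crossingCount lam x₀ q.1 : ℝ) - crossingCount lam x₀ p.1) - ζ * (q.1 - p.1) ≤
        Real.log (action (slitFn fL fR lam x₀ q.1) q.1 (-q.2)) ∧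
    Real.log (action (slitFn fL fR lam x₀ q.1) q.1 (-q.2)) ≤
      Real.log (action (slitFn fL fR lam x₀ p.1) p.1 (-p.2)) +
      Real.log (4 / m) * ((crossingCount lam x₀ q.1 : ℝ) - crossingCount lam x₀ p.1) +
        ζ * (q.1 - p.1) := by
  have hM := C.one_le_M
  have hV := C.three_M_le
  obtain ⟨h1, h2⟩ := H.next_of_downward C.bL C.bR hp hpq hx (by linarith) (by linarith)
  have bp := slitBounds_slitFn (lam := lam) (x₀ := x₀) C.bL C.bR p.1
  have bq := slitBounds_slitFn (lam := lam) (x₀ := x₀) C.bL C.bR q.1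
  have hδ : 0 < q.1 - p.1 := by linarith [hpq.1]
  set f := slitFn fL fR lam x₀ p.1 with hf
  set g := slitFn fL fR lam x₀ q.1 with hg
  set u := -p.2 with hu
  have hgd := abs_le.1 (bq.deriv_le q.1)
  have hu2 : u * (q.1 - p.1) ≤ 2 := by
    rw [h1]; linarith [bp.upper p.1, bq.upper q.1, C.m_pos]
  have hq : action g q.1 (-q.2) = (u - deriv g q.1) * g q.1 := by
    unfold action; rw [h2, hu]; ring
  have hIp : (V₀ - M) * m ≤ action f p.1 u :=
    (mul_le_mul_of_nonneg_right (by linarith) C.m_pos.le).trans (le_action bp C.m_pos (by linarith))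
  have hIq : (u - M) * m ≤ (u - deriv g q.1) * g q.1 :=
    mul_le_mul (by linarith [hgd.2]) (bq.lower _) C.m_pos.le (by linarith [hgd.2])
  have hIq' : (V₀ - M) * m ≤ (u - deriv g q.1) * g q.1 :=
    (mul_le_mul_of_nonneg_right (by linarith) C.m_pos.le).trans hIq
  refine ⟨hu2, by rw [h1]; linarith [bp.lower p.1, bq.lower q.1], by linarith [hgd.2], ?_⟩
  rw [hq]
  obtain ⟨s1, s2⟩ := C.flight_short (show V₀ ≤ u by linarith) hu2 hδ H.lam_pos H.lam_lt_one
  rcases crossing_between (fL := fL) (fR := fR) H.lam_pos H.lam_lt_one hpq.1 s1 s2 hp.1 hx with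
    ⟨hN, hfg⟩ | ⟨hN, k, hk⟩
  · rw [← hf, ← hg] at hfg
    rw [hN, sub_self, mul_zero, mul_zero, add_zero]
    rw [hfg] at h1 hIq' ⊢
    have h3 := abs_action_sub_le bp C.m_pos hpq.1 h1
    refine ⟨C.log_sub_log_le hIp hIq' hδ.le h3, ?_⟩
    rw [abs_sub_comm] at h3
    linarith [C.log_sub_log_le hIq' hIp hδ.le h3]
  · have hc : ∃ c ∈ Ioo p.1 q.1, γ * f c ≤ g c := by
      rcases hk with ⟨hc, e1, e2⟩ | ⟨hc, e1, e2⟩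
      · refine ⟨_, hc, ?_⟩
        rw [hf, hg, e1, e2, periodic_two_mul H.periodic_left, periodic_two_mul H.periodic_right]
        exact C.lower_rightward
      · refine ⟨_, hc, ?_⟩
        rw [hf, hg, e1, e2, periodic_two_mul H.periodic_left, periodic_two_mul H.periodic_right]
        exact C.lower_leftward
    obtain ⟨c, hc, hfg⟩ := hc
    obtain ⟨h3, h4⟩ := abs_action_sub_le_of_crossing bp bq C.m_pos hc (by linarith) h1
    have h5 := C.log_add_le_of_jump hIp h3 h4
      (by have := mul_le_mul_of_nonneg_left hfg (show 0 ≤ u by linarith); linarith)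
    have hNr : (crossingCount lam x₀ q.1 : ℝ) - crossingCount lam x₀ p.1 = 1 := by
      rw [hN]; push_cast; ring
    have hζδ : 0 < ζ * (q.1 - p.1) := mul_pos C.zeta_pos hδ
    rw [hNr, mul_one, mul_one]
    refine ⟨by linarith, ?_⟩
    have hIp0 := C.action_pos.trans_le hIp
    have hIq0 := C.action_pos.trans_le hIq'
    have h6 : (u - deriv g q.1) * g q.1 ≤ action f p.1 u * (4 / m) := by
      have a1 : (u - deriv g q.1) * g q.1 ≤ (u + M) * 1 :=
        mul_le_mul (by linarith [hgd.1]) (by linarith [bq.upper q.1, C.m_pos])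
          (C.m_pos.le.trans (bq.lower _)) (by linarith)
      have a2 : (u - M) * m ≤ action f p.1 u := le_action bp C.m_pos (by linarith)
      have a3 : (u - M) * m * (4 / m) ≤ action f p.1 u * (4 / m) :=
        mul_le_mul_of_nonneg_right a2 (div_pos (by norm_num) C.m_pos).le
      have a4 : (u - M) * m * (4 / m) = 4 * (u - M) := by
        have := C.m_pos.ne'
        field_simp
      linarith
    have h7 := Real.log_le_log hIq0 h6
    rw [Real.log_mul hIp0.ne' (div_pos (by norm_num) C.m_pos).ne'] at h7
    linarith

/-- Along a flight in the upper chamber, the logarithm of the action decreases by at least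
`2 * ζ` at a crossing, up to `ζ` times the duration of the flight. -/
theorem upper_step (H : LowerTrap fL fR lam x₀) {p q : ℝ × ℝ}
    (hp : IsCollisionState fL fR lam x₀ p) (hpq : IsNextCollision fL fR lam x₀ p q)
    (hx : xPos x₀ q.1 ≠ lam) (hv : V₀ + 2 * M ≤ q.2) :
    V₀ ≤ p.2 ∧ 2 * m ≤ p.2 * (q.1 - p.1) ∧
    Real.log (action (fun t => 1 - slitFn fL fR lam x₀ q.1 t) q.1 q.2) +
      2 * ζ * ((crossingCount lam x₀ q.1 : ℝ) - crossingCount lam x₀ p.1) - ζ * (q.1 - p.1) ≤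
        Real.log (action (fun t => 1 - slitFn fL fR lam x₀ p.1 t) p.1 p.2) := by
  have hM := C.one_le_M
  have hV := C.three_M_le
  have bp' := slitBounds_slitFn (lam := lam) (x₀ := x₀) C.bL C.bR p.1
  have bq' := slitBounds_slitFn (lam := lam) (x₀ := x₀) C.bL C.bR q.1
  have hgd := abs_le.1 (bq'.deriv_le q.1)
  have hpabs : V₀ ≤ |p.2| := by
    have h := hpq.2.2.2
    rw [slitVel_eq, flightVel] at h
    have h2 : |p.2| = |(-1 : ℝ) ^ ⌊unfolded fL fR lam x₀ p q.1⌋ * p.2| := by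
      rw [abs_mul, abs_neg_one_zpow', one_mul]
    rw [h2]
    have := neg_le_abs ((-1 : ℝ) ^ ⌊unfolded fL fR lam x₀ p q.1⌋ * p.2)
    linarith [hgd.2]
  obtain ⟨h1, h2⟩ := H.prev_of_upward C.bL C.bR hp hpq hx (by linarith) (by linarith)
    (by linarith)
  have bp := bp'.one_sub
  have bq := bq'.one_sub
  have hδ : 0 < q.1 - p.1 := by linarith [hpq.1]
  have hd : deriv (fun t => 1 - slitFn fL fR lam x₀ q.1 t) q.1 =
      -deriv (slitFn fL fR lam x₀ q.1) q.1 := by rw [deriv_const_sub]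
  set g' := slitFn fL fR lam x₀ q.1 with hg'
  set f' := slitFn fL fR lam x₀ p.1 with hf'
  set f : ℝ → ℝ := fun t => 1 - f' t with hf
  set g : ℝ → ℝ := fun t => 1 - g' t with hg
  set u := p.2 with hu
  have h1' : u * (q.1 - p.1) = f p.1 + g q.1 := h1
  have hu0 : V₀ ≤ u := by
    have : 0 < u := by
      by_contra h
      push Not at h
      have h3 := mul_nonpos_of_nonpos_of_nonneg h hδ.le
      have h4 := bp.lower p.1
      have h5 := bq.lower q.1
      linarith [C.m_pos]
    rwa [abs_of_pos this] at hpabs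
  have hgd' := abs_le.1 (bq.deriv_le q.1)
  have hu2 : u * (q.1 - p.1) ≤ 2 := by
    rw [h1']; linarith [bp.upper p.1, bq.upper q.1, C.m_pos]
  have hq : action g q.1 q.2 = (u - deriv g q.1) * g q.1 := by
    unfold action; rw [h2, hd]; ring
  have hIp : (V₀ - M) * m ≤ action f p.1 u :=
    (mul_le_mul_of_nonneg_right (by linarith) C.m_pos.le).trans (le_action bp C.m_pos (by linarith))
  have hIq : (V₀ - M) * m ≤ (u - deriv g q.1) * g q.1 :=
    mul_le_mul (by linarith [hgd'.2]) (bq.lower _) C.m_pos.le (by linarith [hgd'.2])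
  refine ⟨hu0, by rw [h1']; linarith [bp.lower p.1, bq.lower q.1], ?_⟩
  rw [hq]
  obtain ⟨s1, s2⟩ := C.flight_short hu0 hu2 hδ H.lam_pos H.lam_lt_one
  rcases crossing_between (fL := fL) (fR := fR) H.lam_pos H.lam_lt_one hpq.1 s1 s2 hp.1 hx with
    ⟨hN, hfg⟩ | ⟨hN, k, hk⟩
  · rw [← hf', ← hg'] at hfg
    have hgf : g = f := by rw [hg, hf, hfg]
    rw [hN, sub_self, mul_zero, add_zero]
    rw [hgf] at h1' hIq ⊢
    have h3 := abs_action_sub_le bp C.m_pos hpq.1 h1'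
    rw [abs_sub_comm] at h3
    exact C.log_sub_log_le hIq hIp hδ.le h3
  · have hc : ∃ c ∈ Ioo p.1 q.1, γ * g c ≤ f c := by
      rcases hk with ⟨hc, e1, e2⟩ | ⟨hc, e1, e2⟩
      · refine ⟨_, hc, ?_⟩
        simp only [hf, hg]
        rw [hf', hg', e1, e2, periodic_two_mul H.periodic_left, periodic_two_mul H.periodic_right]
        exact C.upper_rightward
      · refine ⟨_, hc, ?_⟩
        simp only [hf, hg]
        rw [hf', hg', e1, e2, periodic_two_mul H.periodic_left, periodic_two_mul H.periodic_right]
        exact C.upper_leftward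
    obtain ⟨c, hc, hfg⟩ := hc
    obtain ⟨h3, h4⟩ := abs_action_sub_le_of_crossing bp bq C.m_pos hc (by linarith) h1'
    have h5 := C.log_add_le_of_jump hIq h4 h3
      (by have := mul_le_mul_of_nonneg_left hfg (show 0 ≤ u by linarith); linarith)
    have hNr : (crossingCount lam x₀ q.1 : ℝ) - crossingCount lam x₀ p.1 = 1 := by
      rw [hN]; push_cast; ring
    have hζδ : 0 < ζ * (q.1 - p.1) := mul_pos C.zeta_pos hδ
    rw [hNr, mul_one]
    linarith

end SpeedConstants

end

/-! ### Growth in the lower chamber, decay in the upper chamber -/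

theorem exists_gt_of_gap_le {t : ℕ → ℝ} {η : ℝ} (hη : 0 < η) {k : ℕ}
    (h : ∀ n, η ≤ t (k + n + 1) - t (k + n)) (B : ℝ) : ∃ n, B < t (k + n) := by
  have h1 : ∀ n : ℕ, t k + n * η ≤ t (k + n) := by
    intro n
    induction n with
    | zero => simp
    | succ n ih => push_cast; rw [← add_assoc]; linarith [h n]
  obtain ⟨n, hn⟩ := exists_nat_gt ((B - t k) / η)
  rw [div_lt_iff₀ hη] at hn
  exact ⟨n, by linarith [h1 n]⟩

section

variable {fL fR : ℝ → ℝ} {lam x₀ : ℝ} {m M γ ζ V₀ : ℝ}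

namespace SpeedConstants

variable (C : SpeedConstants fL fR lam x₀ m M γ ζ V₀)
include C

/-- A bound for the action bounds the speed. -/
theorem le_of_log_action {d : ℝ → ℝ} (b : SlitBounds m M d) {t u B : ℝ} (hu : M < u)
    (h : Real.log (action d t u) ≤ B) : u ≤ Real.exp B / m + M := by
  have h1 := le_action (t := t) b C.m_pos hu.le
  have h2 : 0 < (u - M) * m := mul_pos (by linarith) C.m_pos
  have h3 := (Real.log_le_iff_le_exp (h2.trans_le h1)).1 h
  have h4 : u - M ≤ Real.exp B / m := (le_div_iff₀ C.m_pos).2 (h1.trans h3)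
  linarith

/-- If the speed `u` is at least `M + W * exp (4 * ζ) / m`, then an action that is not smaller by
more than the factor `exp (-4 * ζ)` still forces the speed to be at least `W - M`. -/
theorem le_add_of_log_action {d d' : ℝ → ℝ} (b : SlitBounds m M d) (b' : SlitBounds m M d')
    {t t' u u' W : ℝ} (hW : 0 < W) (hu : M + W * Real.exp (4 * ζ) / m ≤ u) (hu' : M ≤ u')
    (hpos : 0 < action d' t' u')
    (h : Real.log (action d t u) - 4 * ζ ≤ Real.log (action d' t' u')) : W ≤ u' + M := by
  have h0 : 0 < W * Real.exp (4 * ζ) / m :=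
    div_pos (mul_pos hW (Real.exp_pos _)) C.m_pos
  have h1 := le_action (t := t) b C.m_pos (show M ≤ u by linarith)
  have h2 : W * Real.exp (4 * ζ) ≤ action d t u := by
    refine le_trans ?_ h1
    rw [← div_le_iff₀ C.m_pos]; linarith
  have h3 := Real.log_le_log (mul_pos hW (Real.exp_pos _)) h2
  rw [Real.log_mul hW.ne' (Real.exp_pos _).ne', Real.log_exp] at h3
  exact ((Real.log_le_log_iff hW hpos).1 (by linarith)).trans (action_le b' C.m_pos hu')

/-- A ball that is in the lower chamber at a high speed stays there for ever and its speed grows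
exponentially. -/
theorem growsExponentially (H : LowerTrap fL fR lam x₀) {o : ℕ → ℝ × ℝ}
    (ho : IsOrbit fL fR lam x₀ o) {k : ℕ}
    (hk : (o k).2 ≤ -(M + (V₀ + M) * Real.exp (4 * ζ) / m)) : GrowsExponentially o := by
  have hM := C.one_le_M
  have hV := C.three_M_le
  have hζ := C.zeta_pos
  set L : ℕ → ℝ := fun n => Real.log (action (slitFn fL fR lam x₀ (o n).1) (o n).1 (-(o n).2))
    with hL
  set N : ℕ → ℝ := fun n => crossingCount lam x₀ (o n).1 with hN
  have bs : ∀ t, SlitBounds m M (slitFn fL fR lam x₀ t) := slitBounds_slitFn C.bL C.bR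
  have hstep := fun n (hv : (o n).2 ≤ -V₀) =>
    C.lower_step H (ho n).1 (ho n).2 (ho (n + 1)).1.1 hv
  have hexp : 1 ≤ Real.exp (4 * ζ) := Real.one_le_exp (by linarith)
  have hm1 : m ≤ 1 := by linarith [C.bL.lower 0, (H.left_mem 0).2]
  have hstart : (o k).2 ≤ -V₀ := by
    have h1 : V₀ + M ≤ (V₀ + M) * Real.exp (4 * ζ) := le_mul_of_one_le_right (by linarith) hexp
    have h2 : V₀ + M ≤ (V₀ + M) * Real.exp (4 * ζ) / m := by
      rw [le_div_iff₀ C.m_pos]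
      exact (mul_le_of_le_one_right (by linarith) hm1).trans h1
    linarith
  -- two crossings per period contribute `2 * ζ` each, up to a bounded error, which is twice the
  -- possible loss `ζ` per unit of time; hence the speed never drops below `V₀`
  have main : ∀ j, (o (k + j)).2 ≤ -V₀ ∧
      L k + 2 * ζ * (N (k + j) - N k) - ζ * ((o (k + j)).1 - (o k).1) ≤ L (k + j) ∧
      L (k + j) ≤ L k + Real.log (4 / m) * (N (k + j) - N k) + ζ * ((o (k + j)).1 - (o k).1) := by
    intro j
    induction j with
    | zero => simp [hstart]
    | succ j ih =>
      obtain ⟨h1, h2, h3⟩ := ih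
      obtain ⟨-, -, s0, s1, s2⟩ := hstep (k + j) h1
      have e1 : L k + 2 * ζ * (N (k + (j + 1)) - N k) - ζ * ((o (k + (j + 1))).1 - (o k).1) ≤
          L (k + (j + 1)) := by
        simp only [hL, hN] at *
        rw [← add_assoc]
        linarith
      refine ⟨?_, e1, ?_⟩
      · have h4 := crossingCount_sub_ge (lam := lam) (x₀ := x₀) (o k).1 (o (k + (j + 1))).1
        have h5 : 2 * ζ * ((o (k + (j + 1))).1 - (o k).1 - 2) ≤ 2 * ζ * (N (k + (j + 1)) - N k) :=
          mul_le_mul_of_nonneg_left h4 (by linarith)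
        have hmono : ∀ i, (o k).1 ≤ (o (k + i)).1 := by
          intro i
          induction i with
          | zero => exact le_rfl
          | succ i ih => exact ih.trans (ho (k + i)).2.1.le
        have h6 : 0 ≤ ζ * ((o (k + (j + 1))).1 - (o k).1) :=
          mul_nonneg hζ.le (by linarith [hmono (j + 1)])
        have h7 : action (slitFn fL fR lam x₀ (o (k + (j + 1))).1) (o (k + (j + 1))).1
            (-(o (k + (j + 1))).2) > 0 := by
          obtain ⟨r1, r2⟩ := H.next_of_downward C.bL C.bR (ho (k + j)).1 (ho (k + j)).2
            (ho (k + j + 1)).1.1 (by linarith) (by linarith)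
          have r3 := abs_le.1 ((bs (o (k + j + 1)).1).deriv_le (o (k + j + 1)).1)
          refine mul_pos ?_ (H.slitFn_mem _ _).1
          rw [← add_assoc, r2]
          linarith [r3.2]
        have := C.le_add_of_log_action (bs (o k).1) (bs (o (k + (j + 1))).1) (W := V₀ + M)
          (t := (o k).1) (t' := (o (k + (j + 1))).1) (u := -(o k).2) (u' := -(o (k + (j + 1))).2)
          (by linarith) (by linarith) (by rw [← add_assoc]; linarith) h7
          (by simp only [hL] at e1; linarith)
        linarith
      · simp only [hL, hN] at *
        rw [← add_assoc]
        linarith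
  have hmono : Monotone fun n => (o n).1 := monotone_nat_of_le_succ fun n => (ho n).2.1.le
  have hNle : ∀ j, N (k + j) - N k ≤ (o (k + j)).1 - (o k).1 + 2 := fun j =>
    crossingCount_sub_le _ _
  have hNge : ∀ j, (o (k + j)).1 - (o k).1 - 2 ≤ N (k + j) - N k := fun j =>
    crossingCount_sub_ge _ _
  -- in a bounded time the action stays bounded, hence the flights do not become short
  have hunb : ∀ B, ∃ n, B < (o n).1 := by
    by_contra hcon
    push Not at hcon
    obtain ⟨B, hB⟩ := hcon
    set E := L k + Real.log (4 / m) * (B - (o k).1 + 2) + ζ * (B - (o k).1) with hE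
    have hG : 0 ≤ Real.log (4 / m) :=
      Real.log_nonneg (by rw [le_div_iff₀ C.m_pos]; linarith)
    have hu : ∀ j, -(o (k + j)).2 ≤ Real.exp E / m + M := by
      intro j
      obtain ⟨h1, h2, h3⟩ := main j
      refine C.le_of_log_action (bs (o (k + j)).1) (t := (o (k + j)).1) (by linarith) ?_
      have h4 : Real.log (4 / m) * (N (k + j) - N k) ≤ Real.log (4 / m) * (B - (o k).1 + 2) :=
        mul_le_mul_of_nonneg_left (by linarith [hNle j, hB (k + j)]) hG
      have h5 : ζ * ((o (k + j)).1 - (o k).1) ≤ ζ * (B - (o k).1) :=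
        mul_le_mul_of_nonneg_left (by linarith [hB (k + j)]) hζ.le
      exact h3.trans (by linarith)
    have hUpos : 0 < Real.exp E / m + M :=
      add_pos (div_pos (Real.exp_pos _) C.m_pos) (by linarith)
    obtain ⟨n, hn⟩ := exists_gt_of_gap_le (t := fun n => (o n).1) (k := k)
      (η := 2 * m / (Real.exp E / m + M)) (div_pos (by linarith [C.m_pos]) hUpos) (fun j => by
        rw [div_le_iff₀ hUpos]
        have h1 := (hstep (k + j) (main j).1).2.1
        have h2 := mul_le_mul_of_nonneg_right (hu j)
          (show 0 ≤ (o (k + j + 1)).1 - (o (k + j)).1 by linarith [(ho (k + j)).2.1])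
        linarith) B
    exact absurd (hB (k + n)) (not_le.2 hn)
  refine ⟨tendsto_atTop_atTop_of_monotone hmono fun B => (hunb B).imp fun n h => h.le,
    Real.exp (L k - 4 * ζ - ζ * (o k).1 - 2 * ζ) / 2, by positivity, ζ, hζ, (o k).1, ?_⟩
  intro s hs n hn1 hn2
  have hkn : k ≤ n := by
    by_contra h
    push Not at h
    have h1 := hmono (show n + 1 ≤ k by omega)
    simp only at h1
    linarith
  obtain ⟨j, rfl⟩ := Nat.exists_eq_add_of_le hkn
  obtain ⟨h1, h2, -⟩ := main j
  have hδ := (hstep (k + j) h1).1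
  have hdur : (o (k + j + 1)).1 - (o (k + j)).1 ≤ 2 := by
    have h3 : 0 ≤ (o (k + j + 1)).1 - (o (k + j)).1 := by linarith [(ho (k + j)).2.1]
    have h4 := mul_le_mul_of_nonneg_right (show (1 : ℝ) ≤ -(o (k + j)).2 by linarith) h3
    linarith
  have hlog : L k - 4 * ζ - ζ * (o k).1 - 2 * ζ + ζ * s ≤ L (k + j) := by
    have h5 : 2 * ζ * ((o (k + j)).1 - (o k).1 - 2) ≤ 2 * ζ * (N (k + j) - N k) :=
      mul_le_mul_of_nonneg_left (hNge j) (by linarith)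
    have h6 : ζ * (s - 2) ≤ ζ * (o (k + j)).1 :=
      mul_le_mul_of_nonneg_left (by linarith) hζ.le
    linarith
  have hI0 : 0 < action (slitFn fL fR lam x₀ (o (k + j)).1) (o (k + j)).1 (-(o (k + j)).2) :=
    lt_of_lt_of_le (mul_pos (by linarith) C.m_pos)
      (le_action (bs _) C.m_pos (show M ≤ -(o (k + j)).2 by linarith))
  have h7 := (Real.le_log_iff_exp_le hI0).1 hlog
  have h8 := action_le (t := (o (k + j)).1) (bs (o (k + j)).1) C.m_pos
    (show M ≤ -(o (k + j)).2 by linarith)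
  rw [Real.exp_add] at h7
  have h9 := neg_le_abs (o (k + j)).2
  linarith

/-- The speed of a ball cannot be high in the upper chamber infinitely often: backwards in time, it
would have grown exponentially. -/
theorem not_frequently_upward (H : LowerTrap fL fR lam x₀) {o : ℕ → ℝ × ℝ}
    (ho : IsOrbit fL fR lam x₀ o) :
    ¬ ∀ k, ∃ n ≥ k, M + (V₀ + 3 * M) * Real.exp (4 * ζ) / m ≤ (o n).2 := by
  intro hinf
  have hM := C.one_le_M
  have hV := C.three_M_le
  have hζ := C.zeta_pos
  set L : ℕ → ℝ := fun n =>
    Real.log (action (fun t => 1 - slitFn fL fR lam x₀ (o n).1 t) (o n).1 (o n).2) with hL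
  set N : ℕ → ℝ := fun n => crossingCount lam x₀ (o n).1 with hN
  have bs : ∀ t, SlitBounds m M (fun s => 1 - slitFn fL fR lam x₀ t s) := fun t =>
    (slitBounds_slitFn C.bL C.bR t).one_sub
  have hmono : Monotone fun n => (o n).1 := monotone_nat_of_le_succ fun n => (ho n).2.1.le
  have hstep := fun n (hv : V₀ + 2 * M ≤ (o (n + 1)).2) =>
    C.upper_step H (ho n).1 (ho n).2 (ho (n + 1)).1.1 hv
  have hexp : 1 ≤ Real.exp (4 * ζ) := Real.one_le_exp (by linarith)
  have hm1 : m ≤ 1 := by linarith [C.bL.lower 0, (H.left_mem 0).2]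
  have hback : ∀ n, M + (V₀ + 3 * M) * Real.exp (4 * ζ) / m ≤ (o n).2 → ∀ j k, k + j = n →
      V₀ + 2 * M ≤ (o k).2 ∧
      L n + 2 * ζ * (N n - N k) - ζ * ((o n).1 - (o k).1) ≤ L k := by
    intro n hn j
    induction j with
    | zero =>
      rintro k rfl
      rw [add_zero] at *
      refine ⟨?_, by simp⟩
      have h1 : V₀ + 3 * M ≤ (V₀ + 3 * M) * Real.exp (4 * ζ) :=
        le_mul_of_one_le_right (by linarith) hexp
      have h2 : V₀ + 3 * M ≤ (V₀ + 3 * M) * Real.exp (4 * ζ) / m := by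
        rw [le_div_iff₀ C.m_pos]
        exact (mul_le_of_le_one_right (by linarith) hm1).trans h1
      linarith
    | succ j ih =>
      intro k hkn
      obtain ⟨h1, h2⟩ := ih (k + 1) (by omega)
      obtain ⟨s0, -, s1⟩ := hstep k h1
      have e1 : L n + 2 * ζ * (N n - N k) - ζ * ((o n).1 - (o k).1) ≤ L k := by
        simp only [hL, hN] at *
        linarith
      refine ⟨?_, e1⟩
      have h4 := crossingCount_sub_ge (lam := lam) (x₀ := x₀) (o k).1 (o n).1
      have h5 : 2 * ζ * ((o n).1 - (o k).1 - 2) ≤ 2 * ζ * (N n - N k) :=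
        mul_le_mul_of_nonneg_left h4 (by linarith)
      have h6 : 0 ≤ ζ * ((o n).1 - (o k).1) :=
        mul_nonneg hζ.le (by have := hmono (show k ≤ n by omega); simp only at this; linarith)
      have h7 := le_action (t := (o k).1) (bs (o k).1) C.m_pos (show M ≤ (o k).2 by linarith)
      have := C.le_add_of_log_action (bs (o n).1) (bs (o k).1) (W := V₀ + 3 * M)
        (t := (o n).1) (t' := (o k).1) (u := (o n).2) (u' := (o k).2)
        (by linarith) hn (by linarith)
        ((mul_pos (by linarith) C.m_pos).trans_le h7) (by simp only [hL] at e1; linarith)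
      linarith
  have hhigh : ∀ k, V₀ + 2 * M ≤ (o k).2 := by
    intro k
    obtain ⟨n, hnk, hn⟩ := hinf k
    exact (hback n hn (n - k) k (by omega)).1
  have hchain : ∀ k, L k + 2 * ζ * (N k - N 0) - ζ * ((o k).1 - (o 0).1) ≤ L 0 := by
    intro k
    induction k with
    | zero => simp
    | succ k ih =>
      obtain ⟨-, -, s1⟩ := hstep k (hhigh (k + 1))
      simp only [hL, hN] at *
      linarith
  have hchain' : ∀ k, L k + ζ * ((o k).1 - (o 0).1) - 4 * ζ ≤ L 0 := by
    intro k
    have h5 : 2 * ζ * ((o k).1 - (o 0).1 - 2) ≤ 2 * ζ * (N k - N 0) :=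
      mul_le_mul_of_nonneg_left (crossingCount_sub_ge _ _) (by linarith)
    linarith [hchain k]
  -- the growth backwards in time bounds the times of the orbit, although its speed is bounded
  have hbound : ∀ k, (o k).1 ≤ (o 0).1 + (L 0 + 4 * ζ - Real.log ((V₀ - M) * m)) / ζ := by
    intro k
    have h1 : Real.log ((V₀ - M) * m) ≤ L k := by
      refine Real.log_le_log C.action_pos ?_
      exact (mul_le_mul_of_nonneg_right (by linarith [hhigh k]) C.m_pos.le).trans
        (le_action (bs (o k).1) C.m_pos (by linarith [hhigh k]))
    have h2 : (o k).1 - (o 0).1 ≤ (L 0 + 4 * ζ - Real.log ((V₀ - M) * m)) / ζ := by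
      rw [le_div_iff₀ hζ]
      linarith [hchain' k]
    linarith
  have hu : ∀ k, (o k).2 ≤ Real.exp (L 0 + 4 * ζ) / m + M := by
    intro k
    refine C.le_of_log_action (bs (o k).1) (t := (o k).1) (by linarith [hhigh k]) ?_
    have h1 : 0 ≤ ζ * ((o k).1 - (o 0).1) :=
      mul_nonneg hζ.le (by have := hmono (Nat.zero_le k); simp only at this; linarith)
    have h2 := hchain' k
    simp only [hL] at h2 ⊢
    linarith
  have hUpos : 0 < Real.exp (L 0 + 4 * ζ) / m + M :=
    add_pos (div_pos (Real.exp_pos _) C.m_pos) (by linarith)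
  obtain ⟨n, hn⟩ := exists_gt_of_gap_le (t := fun n => (o n).1) (k := 0)
    (η := 2 * m / (Real.exp (L 0 + 4 * ζ) / m + M)) (div_pos (by linarith [C.m_pos]) hUpos)
    (fun j => by
      rw [div_le_iff₀ hUpos]
      have h1 := (hstep (0 + j) (hhigh _)).2.1
      have h2 := mul_le_mul_of_nonneg_right (hu (0 + j))
        (show 0 ≤ (o (0 + j + 1)).1 - (o (0 + j)).1 by linarith [(ho (0 + j)).2.1])
      linarith) ((o 0).1 + (L 0 + 4 * ζ - Real.log ((V₀ - M) * m)) / ζ)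
  exact absurd (hbound (0 + n)) (not_le.2 hn)

end SpeedConstants

/-! ### Almost every fast ball gains energy exponentially -/

theorem LowerTrap.ae_gains (H : LowerTrap fL fR lam x₀) : ∃ V : ℝ, 1 < V ∧
    ∀ᵐ p : ℝ × ℝ, V < |p.2| → GainsEnergyExponentially fL fR lam x₀ p := by
  obtain ⟨m, M, γ, ζ, V₀, C⟩ := H.exists_speedConstants
  set V := max 2 (max (M + (V₀ + M) * Real.exp (4 * ζ) / m)
    (M + (V₀ + 3 * M) * Real.exp (4 * ζ) / m)) with hV
  have hV1 : M + (V₀ + M) * Real.exp (4 * ζ) / m ≤ V :=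
    (le_max_left _ _).trans (le_max_right _ _)
  have hV2 : M + (V₀ + 3 * M) * Real.exp (4 * ζ) / m ≤ V :=
    (le_max_right _ _).trans (le_max_right _ _)
  have hV3 : 2 ≤ V := le_max_left _ _
  refine ⟨V, by linarith, ?_⟩
  filter_upwards [H.ae_iterate_mem, H.ae_iterate (H.ae_not_last_above V)] with p hD hlast hp
  set o : ℕ → ℝ × ℝ := fun n => (collisionMap fL fR lam x₀)^[n] p with ho
  have horbit : IsOrbit fL fR lam x₀ o := by
    intro n
    refine ⟨(hD n).1, ?_⟩
    simp only [ho]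
    rw [Function.iterate_succ_apply']
    exact (collisionMap_spec (hD n)).1
  by_contra hcon
  have hnot : ¬ GrowsExponentially o := fun h => hcon ⟨o, rfl, horbit, h⟩
  have hup : ∀ n, V < |(o n).2| → V < (o n).2 := by
    intro n hn
    rcases lt_abs.1 hn with h | h
    · exact h
    · exact absurd (C.growsExponentially H horbit (k := n) (by linarith)) hnot
  have hinf : ∀ k, ∃ n ≥ k, V < |(o n).2| := by
    intro k
    induction k with
    | zero => exact ⟨0, le_rfl, hp⟩
    | succ k ih =>
      obtain ⟨n, hnk, hn⟩ := ih
      obtain ⟨j, hj⟩ := hlast n hn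
      refine ⟨j + 1 + n, by omega, ?_⟩
      simp only [ho]
      rwa [Function.iterate_add_apply]
  refine C.not_frequently_upward H horbit fun k => ?_
  obtain ⟨n, hnk, hn⟩ := hinf k
  exact ⟨n, hnk, hV2.trans (hup n hn).le⟩

end

/-! ### Reflection of the table -/

section

variable {fL fR : ℝ → ℝ} {lam x₀ : ℝ}

theorem fold_one_sub (u : ℝ) : fold (1 - u) = 1 - fold u := by
  have h1 := Int.floor_le u
  have h2 := (Int.lt_floor_add_one u).le
  rcases Int.even_or_odd' ⌊u⌋ with ⟨k, hk | hk⟩ <;> rw [hk] at h1 h2 <;> push_cast at h1 h2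
  · rw [fold_even h1 h2]
    have := fold_even (k := -k) (u := 1 - u) (by push_cast; linarith) (by push_cast; linarith)
    rw [this]; push_cast; ring
  · rw [fold_odd (k := k) h1 (by linarith)]
    have := fold_odd (k := -k - 1) (u := 1 - u) (by push_cast; linarith) (by push_cast; linarith)
    rw [this]; push_cast; ring

theorem neg_one_zpow_floor_one_sub {u : ℝ} (h : (⌊u⌋ : ℝ) < u) :
    (-1 : ℝ) ^ ⌊1 - u⌋ = (-1) ^ ⌊u⌋ := by
  have : ⌊1 - u⌋ = -⌊u⌋ := by
    rw [Int.floor_eq_iff]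
    push_cast
    constructor <;> linarith [Int.lt_floor_add_one u]
  rw [this, zpow_neg, ← inv_zpow, inv_neg_one]

theorem slitVel_one_sub (t : ℝ) : slitVel (fun t => 1 - fL t) (fun t => 1 - fR t) lam x₀ t =
    -slitVel fL fR lam x₀ t := by
  unfold slitVel
  split_ifs <;> rw [deriv_const_sub]

theorem unfolded_one_sub (p : ℝ × ℝ) (s : ℝ) :
    unfolded (fun t => 1 - fL t) (fun t => 1 - fR t) lam x₀ (p.1, -p.2) s =
      1 - unfolded fL fR lam x₀ p s := by
  unfold unfolded slitHeight
  split_ifs <;> ring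

theorem touches_one_sub (s y : ℝ) : Touches (fun t => 1 - fL t) (fun t => 1 - fR t) lam x₀ s
    (1 - y) ↔ Touches fL fR lam x₀ s y := by
  unfold Touches
  rw [sub_right_inj, sub_right_inj]

theorem isCollisionState_one_sub {p : ℝ × ℝ} (h : IsCollisionState fL fR lam x₀ p) :
    IsCollisionState (fun t => 1 - fL t) (fun t => 1 - fR t) lam x₀ (p.1, -p.2) :=
  ⟨h.1, by rw [slitVel_one_sub]; exact fun h' => h.2 (neg_injective h')⟩

theorem isNextCollision_one_sub (hL : ∀ t, fL t ∈ Ioo (0 : ℝ) 1) (hR : ∀ t, fR t ∈ Ioo (0 : ℝ) 1)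
    {p q : ℝ × ℝ} (h : IsNextCollision fL fR lam x₀ p q) :
    IsNextCollision (fun t => 1 - fL t) (fun t => 1 - fR t) lam x₀ (p.1, -p.2) (q.1, -q.2) := by
  have hfl : ∀ s, flightHeight (fun t => 1 - fL t) (fun t => 1 - fR t) lam x₀ (p.1, -p.2) s =
      1 - flightHeight fL fR lam x₀ p s := by
    intro s
    rw [flightHeight, unfolded_one_sub, fold_one_sub, flightHeight]
  have hmem : fold (unfolded fL fR lam x₀ p q.1) ∈ Ioo (0 : ℝ) 1 := by
    rcases h.2.2.1 with ⟨-, h'⟩ | ⟨-, h'⟩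
    · exact (show fold (unfolded fL fR lam x₀ p q.1) = fL q.1 from h') ▸ hL q.1
    · exact (show fold (unfolded fL fR lam x₀ p q.1) = fR q.1 from h') ▸ hR q.1
  refine ⟨h.1, fun s hs => ?_, ?_, ?_⟩
  · rw [hfl, touches_one_sub]
    exact h.2.1 s hs
  · rw [hfl, touches_one_sub]
    exact h.2.2.1
  · simp only
    rw [slitVel_one_sub, flightVel, unfolded_one_sub,
      neg_one_zpow_floor_one_sub (floor_lt_of_fold_mem hmem), h.2.2.2, flightVel]
    ring

/-- The reflection of the table that exchanges the floor and the ceiling. -/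
theorem gains_one_sub (hL : ∀ t, fL t ∈ Ioo (0 : ℝ) 1) (hR : ∀ t, fR t ∈ Ioo (0 : ℝ) 1)
    {p : ℝ × ℝ} (h : GainsEnergyExponentially fL fR lam x₀ p) :
    GainsEnergyExponentially (fun t => 1 - fL t) (fun t => 1 - fR t) lam x₀ (p.1, -p.2) := by
  obtain ⟨o, h0, ho, ht, D, hD, ζ, hζ, T, hT⟩ := h
  refine ⟨fun n => ((o n).1, -(o n).2), by simp only [h0], fun n =>
    ⟨isCollisionState_one_sub (ho n).1, isNextCollision_one_sub hL hR (ho n).2⟩, ht, D, hD, ζ, hζ,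
    T, ?_⟩
  intro s hs n h1 h2
  simp only [abs_neg]
  exact hT s hs n h1 h2

theorem ae_gains (hfL : ContDiff ℝ 2 fL) (hfR : ContDiff ℝ 2 fR)
    (hfLper : Function.Periodic fL 2) (hfRper : Function.Periodic fR 2)
    (hfL01 : ∀ t, fL t ∈ Ioo (0 : ℝ) 1) (hfR01 : ∀ t, fR t ∈ Ioo (0 : ℝ) 1)
    (hlam : lam ∈ Ioo (0 : ℝ) 1)
    (hflip :
      (fL (lam - x₀) < fR (lam - x₀) ∧ fR (2 - lam - x₀) < fL (2 - lam - x₀)) ∨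
      (fR (lam - x₀) < fL (lam - x₀) ∧ fL (2 - lam - x₀) < fR (2 - lam - x₀))) :
    ∃ V : ℝ, 1 < V ∧
      ∀ᵐ p : ℝ × ℝ, V < |p.2| → GainsEnergyExponentially fL fR lam x₀ p := by
  rcases hflip with ⟨h1, h2⟩ | ⟨h1, h2⟩
  · exact LowerTrap.ae_gains
      ⟨hfL, hfR, hfLper, hfRper, hfL01, hfR01, hlam.1, hlam.2, h1, h2⟩
  · have mem : ∀ f : ℝ → ℝ, (∀ t, f t ∈ Ioo (0 : ℝ) 1) → ∀ t, 1 - f t ∈ Ioo (0 : ℝ) 1 :=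
      fun f hf t => ⟨by linarith [(hf t).2], by linarith [(hf t).1]⟩
    obtain ⟨V, hV, hae⟩ := LowerTrap.ae_gains (fL := fun t => 1 - fL t) (fR := fun t => 1 - fR t)
      (lam := lam) (x₀ := x₀)
      ⟨contDiff_const.sub hfL, contDiff_const.sub hfR,
        fun t => by simp only [hfLper t], fun t => by simp only [hfRper t],
        mem fL hfL01, mem fR hfR01, hlam.1, hlam.2, by linarith, by linarith⟩
    refine ⟨V, hV, ?_⟩
    have hmp : MeasurePreserving (Prod.map id Neg.neg : ℝ × ℝ → ℝ × ℝ) volume volume :=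
      (MeasurePreserving.id volume).prod (Measure.measurePreserving_neg volume)
    filter_upwards [hmp.quasiMeasurePreserving.ae hae] with p hp hpV
    have := gains_one_sub (mem fL hfL01) (mem fR hfR01) (hp (by simpa using hpV))
    simpa using this

end

end SlitBilliard

theorem theorem1 (fL fR : ℝ → ℝ) (lam x₀ : ℝ)
    (hfL : ContDiff ℝ 2 fL) (hfR : ContDiff ℝ 2 fR)
    (hfLper : Function.Periodic fL 2) (hfRper : Function.Periodic fR 2)
    (hfL01 : ∀ t, fL t ∈ Set.Ioo (0 : ℝ) 1) (hfR01 : ∀ t, fR t ∈ Set.Ioo (0 : ℝ) 1)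
    (hlam : lam ∈ Set.Ioo (0 : ℝ) 1) (hx₀ : x₀ ∈ Set.Ico (0 : ℝ) lam)
    (hflip :
      (fL (lam - x₀) < fR (lam - x₀) ∧ fR (2 - lam - x₀) < fL (2 - lam - x₀)) ∨
      (fR (lam - x₀) < fL (lam - x₀) ∧ fL (2 - lam - x₀) < fR (2 - lam - x₀))) :
    ∃ V : ℝ, 1 < V ∧
      (∀ᵐ p : ℝ × ℝ, p.1 ∈ Set.Ico (0 : ℝ) 2 → V < |p.2| →
        SlitBilliard.GainsEnergyExponentially fL fR lam x₀ p) ∧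
      MeasureTheory.volume {p : ℝ × ℝ | p.1 ∈ Set.Ico (0 : ℝ) 2 ∧
        ¬ SlitBilliard.GainsEnergyExponentially fL fR lam x₀ p} < ⊤ := by
  obtain ⟨V, hV, hae⟩ := SlitBilliard.ae_gains hfL hfR hfLper hfRper hfL01 hfR01 hlam hflip
  refine ⟨V, hV, hae.mono fun p hp _ => hp, ?_⟩
  -- up to a null set, the exceptional states have a speed of at most `V`
  have hsub : {p : ℝ × ℝ | p.1 ∈ Set.Ico (0 : ℝ) 2 ∧
      ¬ SlitBilliard.GainsEnergyExponentially fL fR lam x₀ p} ≤ᵐ[MeasureTheory.volume]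
      (Set.Icc (0 : ℝ) 2 ×ˢ Set.Icc (-V) V : Set (ℝ × ℝ)) := by
    filter_upwards [hae] with p hp
    rintro ⟨h1, h2⟩
    have h3 : |p.2| ≤ V := not_lt.1 fun h => h2 (hp h)
    exact ⟨⟨h1.1, h1.2.le⟩, abs_le.1 h3⟩
  exact (MeasureTheory.measure_mono_ae hsub).trans_lt
    (isCompact_Icc.prod isCompact_Icc).measure_lt_top
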